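/- In a 2-edge-colored graph (every edge is red or blue), a \emph{red cycle} means a subgraph that is empty, or consists of a single vertex, or consists of a single red edge together with its two ends, or is a cycle (on at least three vertices) all of whose edges are red; a \emph{blue cycle} is defined analogously. Thus the empty graph and one-vertex graphs count as cycles of either color. For every $\eta>0$ there is an $n_0=n_0(\eta)$ such that the following holds. Let $G$ be a simple graph on $n\ge n_0$ vertices with minimum degree $\delta(G)>\left(\frac34+\eta\right)n$. Then for every coloring of the edges of $G$ with the colors red and blue, there are a red cycle and a blue cycle in $G$ that are vertex-disjoint and together cover at least $(1-\eta)n$ vertices of $G$. -/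

import Mathlib

/-- A subgraph `C` of `H` is a cycle in the wide sense customary for cycle partitions: it is
the empty graph, a single vertex, a single edge of `H` (with its two ends), or a genuine cycle
of `H` (on at least three vertices). -/
def SimpleGraph.Subgraph.IsWideCycle {V : Type*} {H : SimpleGraph V} (C : H.Subgraph) : Prop :=
  C = ⊥ ∨
  (∃ v : V, C = H.singletonSubgraph v) ∨
  (∃ (u v : V) (h : H.Adj u v), C = H.subgraphOfAdj h) ∨
  (∃ (v : V) (p : H.Walk v v), p.IsCycle ∧ C = p.toSubgraph)

/-!
# Two monochromatic cycles that cover almost all vertices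

The proof follows the method of connected matchings.

By a regularity lemma for two graphs (`exists_equipartition_isUniform_pair`), the vertices split
into boundedly many clusters of nearly equal size such that almost all pairs of clusters are regular
in both colours. Two clusters are joined in red (or blue) if their pair is regular and not sparse in
red (or blue). After a few clusters have been discarded, every cluster is joined in some colour to
at least three quarters of the clusters (`le_card_clusterGraph_neighbors`, `card_irregular_le`).

The combinatorial core is `HasThreeQuarterDegree.exists_perm`: under this degree condition there are
a red component and a blue component whose union `H` satisfies Hall's condition, so there is a
permutation `σ` of the clusters along edges of `H`. If red, say, is connected, it goes together with
a largest blue component. If neither colour is connected, sort the vertices by their red and their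
blue component: a vertex has neighbours only in its own row and its own column of this grid. The
degree condition forces everything into one row and one column whose common cell has more than half
of the vertices, and every degree in their union is at least half of the number of vertices.

Split each cluster into two halves and match the first half of a cluster `w` with the second half of
`σ w`. This replaces a perfect matching by a perfect fractional one, which only needs Hall's theorem.
The pairs matched in red belong to one red component. Each of them contains an almost spanning red
path (`IsJoined.exists_path`, by depth-first search), and the paths are linked to a cycle through
a small reserve kept in every cluster (`exists_isWideCycle_of_connected_matching`). The same is done
in blue with reserves of its own, so the two cycles are disjoint.
-/

open Finset SzemerediRegularity

/-! ### Regularity for two graphs -/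

namespace SimpleGraph

/-- If `U` and `V` are cut into `N` pieces each, all of size `m` or `m + 1`, then the mean square
density over pairs of pieces is at least the square density of `(U, V)`, up to `δ ≥ 4 / m`. The
mean density is at least `(m / (m + 1)) ^ 2` times the density of `(U, V)`, and the mean square is
at least the square of the mean. -/
theorem sq_edgeDensity_sub_le_average {α : Type*} [DecidableEq α] (G : SimpleGraph α)
    [DecidableRel G.Adj] {U V : Finset α} (P : Finpartition U) (Q : Finpartition V) {m N : ℕ}
    {δ : ℝ} (hm : 0 < m) (hN : 0 < N) (hδ₀ : 0 ≤ δ) (hδ : δ ≤ 1) (hmδ : 4 ≤ δ * m)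
    (hPN : #P.parts = N) (hQN : #Q.parts = N)
    (hP : ∀ A ∈ P.parts, m ≤ #A ∧ #A ≤ m + 1) (hQ : ∀ A ∈ Q.parts, m ≤ #A ∧ #A ≤ m + 1) :
    (G.edgeDensity U V : ℝ) ^ 2 - δ ≤
      (∑ x ∈ P.parts ×ˢ Q.parts, (G.edgeDensity x.1 x.2 : ℝ) ^ 2) / (N : ℝ) ^ 2 := by
  have hm' : (0 : ℝ) < m := by exact_mod_cast hm
  have hN' : (0 : ℝ) < N := by exact_mod_cast hN
  have hcard : (#(P.parts ×ˢ Q.parts) : ℝ) = (N : ℝ) ^ 2 := by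
    rw [card_product, hPN, hQN]; push_cast; ring
  have hU : (N * m : ℝ) ≤ #U := by
    rw [← P.sum_card_parts, ← hPN]
    exact_mod_cast card_nsmul_le_sum _ _ _ fun x hx => (hP x hx).1
  have hV : (N * m : ℝ) ≤ #V := by
    rw [← Q.sum_card_parts, ← hQN]
    exact_mod_cast card_nsmul_le_sum _ _ _ fun x hx => (hQ x hx).1
  have hd : (G.edgeDensity U V : ℝ) =
      (∑ x ∈ P.parts ×ˢ Q.parts, (#(G.interedges x.1 x.2) : ℝ)) / (#U * #V) := by
    rw [SimpleGraph.edgeDensity_def, SimpleGraph.interedges,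
      Rel.card_interedges_finpartition _ P Q, Rat.cast_div, Rat.cast_mul, Rat.cast_natCast,
      Rat.cast_natCast, Rat.cast_natCast, Nat.cast_sum]
    rfl
  obtain ⟨E, hE⟩ : ∃ E : ℝ, E = ∑ x ∈ P.parts ×ˢ Q.parts, (#(G.interedges x.1 x.2) : ℝ) :=
    ⟨_, rfl⟩
  have hE0 : 0 ≤ E := hE ▸ sum_nonneg fun _ _ => Nat.cast_nonneg _
  rw [← hE] at hd
  have havg : (1 - δ / 2) * (G.edgeDensity U V : ℝ) ≤
      (∑ x ∈ P.parts ×ˢ Q.parts, (G.edgeDensity x.1 x.2 : ℝ)) / (N : ℝ) ^ 2 := by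
    have h1 : E / (m + 1) ^ 2 ≤ ∑ x ∈ P.parts ×ˢ Q.parts, (G.edgeDensity x.1 x.2 : ℝ) := by
      rw [hE, sum_div]
      refine sum_le_sum fun x hx => ?_
      rw [mem_product] at hx
      obtain ⟨ha, hb⟩ := hP _ hx.1
      obtain ⟨hc, hd⟩ := hQ _ hx.2
      rw [SimpleGraph.edgeDensity_def, Rat.cast_div, Rat.cast_mul, Rat.cast_natCast,
        Rat.cast_natCast, Rat.cast_natCast]
      have ha' : (0 : ℝ) < #x.1 := by exact_mod_cast hm.trans_le ha
      have hc' : (0 : ℝ) < #x.2 := by exact_mod_cast hm.trans_le hc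
      have hb' : (#x.1 : ℝ) ≤ m + 1 := by exact_mod_cast hb
      have hd' : (#x.2 : ℝ) ≤ m + 1 := by exact_mod_cast hd
      have : (#x.1 * #x.2 : ℝ) ≤ (m + 1) ^ 2 := by
        rw [sq]; gcongr
      gcongr
    have h2 : (G.edgeDensity U V : ℝ) ≤ E / (N * m) ^ 2 := by
      rw [hd, sq]
      exact div_le_div_of_nonneg_left hE0 (by positivity) (mul_le_mul hU hV (by positivity)
        (by positivity))
    have h3 : (1 - δ / 2) ≤ (m : ℝ) ^ 2 / (m + 1) ^ 2 := by
      rw [le_div_iff₀ (by positivity)]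
      have h5 : 0 ≤ (δ * m - 4) * m := mul_nonneg (by linarith) hm'.le
      linarith [mul_nonneg hδ₀ hm'.le]
    calc (1 - δ / 2) * (G.edgeDensity U V : ℝ) ≤ (m : ℝ) ^ 2 / (m + 1) ^ 2 * (E / (N * m) ^ 2) := by
          refine mul_le_mul h3 h2 ?_ (by positivity)
          exact_mod_cast G.edgeDensity_nonneg _ _
      _ = E / (m + 1) ^ 2 / N ^ 2 := by field_simp
      _ ≤ _ := by gcongr
  have hd0 : (0 : ℝ) ≤ G.edgeDensity U V := by exact_mod_cast G.edgeDensity_nonneg _ _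
  have hd1 : (G.edgeDensity U V : ℝ) ≤ 1 := by exact_mod_cast G.edgeDensity_le_one _ _
  have hcs := sum_div_card_sq_le_sum_sq_div_card (s := P.parts ×ˢ Q.parts)
    (f := fun x => (G.edgeDensity x.1 x.2 : ℝ))
  rw [hcard] at hcs
  refine le_trans ?_ hcs
  have h4 := pow_le_pow_left₀ (by nlinarith) havg 2
  refine le_trans ?_ h4
  nlinarith [mul_nonneg hδ₀ (sub_nonneg.2 (pow_le_one₀ (n := 2) hd0 hd1)),
    mul_nonneg (sq_nonneg δ) (sq_nonneg (G.edgeDensity U V : ℝ))]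

end SimpleGraph

namespace SzemerediRegularity

variable {α : Type*} [Fintype α] [DecidableEq α] [Nonempty α]
  {P : Finpartition (univ : Finset α)}

/-- The increment partition built for one graph `G` cuts all parts into the same number of pieces
of nearly the same size, so it costs an unrelated graph `H` at most `ε ^ 5 / 25` of its energy. -/
theorem energy_sub_le_energy_increment (hP : P.IsEquipartition) (G H : SimpleGraph α)
    [DecidableRel G.Adj] [DecidableRel H.Adj] {ε : ℝ} (hε₁ : ε ≤ 1)
    (hPε : 100 ≤ 4 ^ #P.parts * ε ^ 5) (hPα : #P.parts * 16 ^ #P.parts ≤ Fintype.card α)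
    (hPG : ¬ P.IsUniform G ε) :
    (P.energy H : ℝ) - ε ^ 5 / 25 ≤ (increment hP G ε).energy H := by
  have hε₀ : 0 < ε := eps_pos hPε
  have hk : 0 < #P.parts := (Finpartition.nonempty_of_not_uniform hPG).card_pos
  have hm := m_pos hPα
  have h100 := hundred_div_ε_pow_five_le_m hPα hPε
  have hlocal : ∀ x : {x // x ∈ P.parts.offDiag},
      (H.edgeDensity x.1.1 x.1.2 : ℝ) ^ 2 - ε ^ 5 / 25 ≤
      (∑ i ∈ (chunk hP G ε (mem_offDiag.1 x.2).1).parts ×ˢ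
        (chunk hP G ε (mem_offDiag.1 x.2).2.1).parts, (H.edgeDensity i.1 i.2 : ℝ) ^ 2) /
          (4 ^ #P.parts : ℕ) ^ 2 := by
    intro x
    refine H.sq_edgeDensity_sub_le_average _ _ hm (by positivity) (by positivity) ?_ ?_
      (card_chunk hm.ne') (card_chunk hm.ne')
      (fun A hA => ⟨m_le_card_of_mem_chunk_parts hA, card_le_m_add_one_of_mem_chunk_parts hA⟩)
      (fun A hA => ⟨m_le_card_of_mem_chunk_parts hA, card_le_m_add_one_of_mem_chunk_parts hA⟩)
    · have := pow_le_one₀ (n := 5) hε₀.le hε₁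
      linarith
    · rw [div_le_iff₀ (by positivity)] at h100
      linarith
  set D : {x // x ∈ P.parts.offDiag} → Finset (Finset α × Finset α) := fun x =>
    (chunk hP G ε (mem_offDiag.1 x.2).1).parts ×ˢ
        (chunk hP G ε (mem_offDiag.1 x.2).2.1).parts with hD
  have hDsub : P.parts.offDiag.attach.biUnion D ⊆ (increment hP G ε).parts.offDiag := by
    rintro ⟨Ui, Vj⟩
    simp only [hD, increment, mem_offDiag, Finpartition.bind_parts, mem_biUnion, Prod.exists,
      mem_product, mem_attach, true_and, Subtype.exists, and_imp,
      mem_offDiag, forall_exists_index, Ne]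
    refine fun U V hUV hUi hVj => ⟨⟨_, hUV.1, hUi⟩, ⟨_, hUV.2.1, hVj⟩, ?_⟩
    rintro rfl
    obtain ⟨i, hi⟩ := Finpartition.nonempty_of_mem_parts _ hUi
    exact hUV.2.2 (P.disjoint.elim_finset hUV.1 hUV.2.1 i (Finpartition.le _ hUi hi) <|
      Finpartition.le _ hVj hi)
  have hDdisj : (P.parts.offDiag.attach : Set {x // x ∈ P.parts.offDiag}).PairwiseDisjoint D := by
    simp +unfoldPartialApp only [hD, Set.PairwiseDisjoint,
      Function.onFun, Finset.disjoint_left, mem_product]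
    rintro ⟨⟨s₁, s₂⟩, hs⟩ _ ⟨⟨t₁, t₂⟩, ht⟩ _ hst ⟨u, v⟩ huv₁ huv₂
    rw [mem_offDiag] at hs ht
    obtain ⟨a, ha⟩ := Finpartition.nonempty_of_mem_parts _ huv₁.1
    obtain ⟨b, hb⟩ := Finpartition.nonempty_of_mem_parts _ huv₁.2
    exact hst <| Subtype.ext <| Prod.ext
      (P.disjoint.elim_finset hs.1 ht.1 a (Finpartition.le _ huv₁.1 ha) <|
        Finpartition.le _ huv₂.1 ha) <|
          P.disjoint.elim_finset hs.2.1 ht.2.1 b (Finpartition.le _ huv₁.2 hb) <|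
            Finpartition.le _ huv₂.2 hb
  have hk' : (0 : ℝ) < #P.parts := by exact_mod_cast hk
  calc
    (P.energy H : ℝ) - ε ^ 5 / 25
      ≤ (∑ x ∈ P.parts.offDiag, ((H.edgeDensity x.1 x.2 : ℝ) ^ 2 - ε ^ 5 / 25)) /
          (#P.parts : ℝ) ^ 2 := by
        rw [Finpartition.coe_energy, sum_sub_distrib, sub_div, sum_const, nsmul_eq_mul]
        refine sub_le_sub_left ?_ _
        rw [div_le_iff₀ (by positivity), mul_comm]
        refine mul_le_mul_of_nonneg_left ?_ (by positivity)
        rw [offDiag_card]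
        exact_mod_cast (Nat.sub_le _ _).trans (sq _).ge
    _ = (∑ x ∈ P.parts.offDiag.attach, ((H.edgeDensity x.1.1 x.1.2 : ℝ) ^ 2 - ε ^ 5 / 25)) /
          (#P.parts : ℝ) ^ 2 := by
        rw [sum_attach P.parts.offDiag fun x => ((H.edgeDensity x.1 x.2 : ℝ) ^ 2 - ε ^ 5 / 25)]
    _ ≤ (∑ x ∈ P.parts.offDiag.attach, (∑ i ∈ D x, (H.edgeDensity i.1 i.2 : ℝ) ^ 2) /
          (4 ^ #P.parts : ℕ) ^ 2) / (#P.parts : ℝ) ^ 2 := by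
        gcongr with x
        exact hlocal x
    _ = (∑ x ∈ P.parts.offDiag.attach, ∑ i ∈ D x, (H.edgeDensity i.1 i.2 : ℝ) ^ 2) /
          (#(increment hP G ε).parts : ℝ) ^ 2 := by
        rw [card_increment hPα hPG, stepBound, ← sum_div, div_div]
        push_cast
        ring_nf
    _ ≤ _ := by
        rw [Finpartition.coe_energy]
        gcongr
        rw [← sum_biUnion hDdisj]
        exact sum_le_sum_of_subset_of_nonneg hDsub fun i _ _ ↦ sq_nonneg _

/-- The energy that `G` gains from its increment partition outweighs what `H` may lose. -/
theorem add_energy_increment (hP : P.IsEquipartition) (G H : SimpleGraph α)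
    [DecidableRel G.Adj] [DecidableRel H.Adj] {ε : ℝ} (hε₁ : ε ≤ 1) (hP₇ : 7 ≤ #P.parts)
    (hPε : 100 ≤ 4 ^ #P.parts * ε ^ 5) (hPα : #P.parts * 16 ^ #P.parts ≤ Fintype.card α)
    (hPG : ¬ P.IsUniform G ε) :
    (P.energy G : ℝ) + P.energy H + ε ^ 5 / 5 ≤
      (increment hP G ε).energy G + (increment hP G ε).energy H := by
  have hε₀ : 0 < ε := eps_pos hPε
  have h1 := energy_increment hP hP₇ hPε hPα hPG hε₀.le hε₁
  have h2 := energy_sub_le_energy_increment hP G H hε₁ hPε hPα hPG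
  have : 0 < ε ^ 5 := by positivity
  linarith

end SzemerediRegularity

/-- **Szemerédi's regularity lemma** for two graphs at once: as long as one of the two graphs is not
uniform, its increment partition raises the sum of the two energies, which is at most `2`. -/
theorem exists_equipartition_isUniform_pair {ε : ℝ} (hε : 0 < ε) (hε₁ : ε ≤ 1) (l : ℕ) :
    ∃ K : ℕ, ∀ (α : Type*) [Fintype α] [DecidableEq α] (G H : SimpleGraph α)
      [DecidableRel G.Adj] [DecidableRel H.Adj], K * 16 ^ K ≤ Fintype.card α →
      ∃ P : Finpartition (univ : Finset α), P.IsEquipartition ∧ l ≤ #P.parts ∧ #P.parts ≤ K ∧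
        P.IsUniform G ε ∧ P.IsUniform H ε := by
  set t := initialBound ε l with ht
  set j := ⌊10 / ε ^ 5⌋₊ + 1 with hj
  refine ⟨stepBound^[j] t, fun α _ _ G H _ _ hα => ?_⟩
  have htK : t ≤ stepBound^[j] t := Function.id_le_iterate_of_id_le le_stepBound _ _
  have htα : t ≤ #(univ : Finset α) := by
    rw [card_univ]
    exact htK.trans ((Nat.le_mul_of_pos_right _ (by positivity)).trans hα)
  have : Nonempty α := by
    rw [← Fintype.card_pos_iff, ← card_univ]
    exact (initialBound_pos _ _).trans_le htα
  obtain ⟨dum, hdum₁, hdum₂⟩ :=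
    Finpartition.exists_equipartition_card_eq (univ : Finset α) (initialBound_pos _ _).ne' htα
  have henergy : ∀ P : Finpartition (univ : Finset α), (P.energy G : ℝ) + P.energy H ≤ 2 := by
    intro P
    have h1 : (P.energy G : ℝ) ≤ 1 := by exact_mod_cast P.energy_le_one G
    have h2 : (P.energy H : ℝ) ≤ 1 := by exact_mod_cast P.energy_le_one H
    linarith
  suffices h : ∀ i ≤ j, ∃ P : Finpartition (univ : Finset α), P.IsEquipartition ∧ t ≤ #P.parts ∧
      #P.parts ≤ stepBound^[i] t ∧ ((P.IsUniform G ε ∧ P.IsUniform H ε) ∨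
        ε ^ 5 / 5 * i ≤ P.energy G + P.energy H) by
    obtain ⟨P, hP₁, hP₂, hP₃, hP₄⟩ := h j le_rfl
    refine ⟨P, hP₁, (le_initialBound _ _).trans hP₂, hP₃, hP₄.resolve_right fun h => ?_⟩
    have h1 := h.trans (henergy P)
    have h2 : 10 / ε ^ 5 < j := by rw [hj]; exact_mod_cast Nat.lt_floor_add_one _
    rw [div_lt_iff₀ (by positivity)] at h2
    linarith
  intro i
  induction i with
  | zero =>
    intro _
    refine ⟨dum, hdum₁, hdum₂.ge, hdum₂.le, Or.inr ?_⟩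
    rw [Nat.cast_zero, mul_zero]
    exact_mod_cast add_nonneg (dum.energy_nonneg G) (dum.energy_nonneg H)
  | succ i ih =>
    intro hi
    obtain ⟨P, hP₁, hP₂, hP₃, hP₄⟩ := ih (by omega)
    by_cases huniform : P.IsUniform G ε ∧ P.IsUniform H ε
    · refine ⟨P, hP₁, hP₂, ?_, Or.inl huniform⟩
      rw [Function.iterate_succ_apply']
      exact hP₃.trans (le_stepBound _)
    replace hP₄ := hP₄.resolve_left huniform
    have hPε : 100 ≤ 4 ^ #P.parts * ε ^ 5 :=
      (hundred_lt_pow_initialBound_mul hε l).le.trans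
        (mul_le_mul_of_nonneg_right (pow_right_mono₀ (by simp) hP₂) <| by positivity)
    have hsize : #P.parts ≤ stepBound^[j] t :=
      hP₃.trans (Function.monotone_iterate_of_id_le le_stepBound (by omega) _)
    have hPα : #P.parts * 16 ^ #P.parts ≤ Fintype.card α :=
      (Nat.mul_le_mul hsize (Nat.pow_le_pow_right (by simp) hsize)).trans hα
    have hP₇ := (seven_le_initialBound ε l).trans hP₂
    rw [not_and_or] at huniform
    obtain hG | hH := huniform
    · refine ⟨increment hP₁ G ε, increment_isEquipartition hP₁ G ε, ?_, ?_, Or.inr ?_⟩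
      · rw [card_increment hPα hG]
        exact hP₂.trans (le_stepBound _)
      · rw [card_increment hPα hG, Function.iterate_succ_apply']
        exact stepBound_mono hP₃
      · have := add_energy_increment hP₁ G H hε₁ hP₇ hPε hPα hG
        rw [Nat.cast_succ]
        linarith
    · refine ⟨increment hP₁ H ε, increment_isEquipartition hP₁ H ε, ?_, ?_, Or.inr ?_⟩
      · rw [card_increment hPα hH]
        exact hP₂.trans (le_stepBound _)
      · rw [card_increment hPα hH, Function.iterate_succ_apply']
        exact stepBound_mono hP₃
      · have := add_energy_increment hP₁ H G hε₁ hP₇ hPε hPα hH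
        rw [Nat.cast_succ]
        linarith

/-! ### Components that carry a perfect fractional matching -/

namespace SimpleGraph

variable {W : Type*}

/-- The union of the component of `r` in `R` and the component of `b` in `B`, as a graph on all
vertices. -/
def componentPair (R B : SimpleGraph W) (r b : W) : SimpleGraph W where
  Adj v w := (R.Adj v w ∧ R.Reachable r v) ∨ (B.Adj v w ∧ B.Reachable b v)
  symm := ⟨fun _ _ h => h.imp (fun h => ⟨h.1.symm, h.2.trans h.1.reachable⟩)
    (fun h => ⟨h.1.symm, h.2.trans h.1.reachable⟩)⟩
  loopless := ⟨fun v h => h.elim (fun h => R.loopless.irrefl v h.1)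
    (fun h => B.loopless.irrefl v h.1)⟩

theorem componentPair_comm (R B : SimpleGraph W) (r b : W) :
    componentPair B R b r = componentPair R B r b := by
  ext v w
  exact Or.comm

variable [Fintype W]

open Classical in
/-- Hall's theorem for the neighbourhood relation of a graph. It is enough to test Hall's condition
on independent sets: removing from `S` the vertices of `S` with a neighbour in `S` removes them from
the neighbourhood as well. -/
theorem exists_perm_adj_of_hall (H : SimpleGraph W)
    (h : ∀ S : Finset W, (∀ v ∈ S, ∀ w ∈ S, ¬ H.Adj v w) → #S ≤ #{w | ∃ v ∈ S, H.Adj v w}) :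
    ∃ σ : Equiv.Perm W, ∀ v, H.Adj v (σ v) := by
  have hall : ∀ S : Finset W, #S ≤ #{w | ∃ v ∈ S, H.Adj v w} := by
    intro S
    set N : Finset W := {w | ∃ v ∈ S, H.Adj v w} with hN
    have hI := h (S \ N) (by
      intro v hv w hw hvw
      simp only [hN, mem_sdiff, mem_filter, mem_univ, true_and] at hv hw
      exact hw.2 ⟨v, hv.1, hvw⟩)
    have hsub : ({w | ∃ v ∈ S \ N, H.Adj v w} : Finset W) ⊆ N \ S := by
      intro w hw
      simp only [mem_filter, mem_univ, true_and] at hw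
      obtain ⟨v, hv, hvw⟩ := hw
      rw [mem_sdiff] at hv ⊢
      refine ⟨mem_filter.2 ⟨mem_univ _, v, hv.1, hvw⟩, fun hwS => hv.2 ?_⟩
      exact mem_filter.2 ⟨mem_univ _, w, hwS, hvw.symm⟩
    have h1 := hI.trans (card_le_card hsub)
    have h2 := card_sdiff_add_card_inter S N
    have h3 := card_sdiff_add_card_inter N S
    rw [inter_comm] at h3
    omega
  obtain ⟨f, hf, hadj⟩ := (Fintype.all_card_le_filter_rel_iff_exists_injective H.Adj).1 (by
    intro S
    simpa using hall S)
  exact ⟨Equiv.ofBijective f hf.bijective_of_finite, hadj⟩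

open Classical in
theorem exists_perm_adj_of_degree (H : SimpleGraph W)
    (h : ∀ v, Fintype.card W ≤ 2 * #{w | H.Adj v w}) :
    ∃ σ : Equiv.Perm W, ∀ v, H.Adj v (σ v) := by
  refine H.exists_perm_adj_of_hall fun S hS => ?_
  obtain rfl | ⟨v, hv⟩ := S.eq_empty_or_nonempty
  · simp
  have h1 : #({w | H.Adj v w} : Finset W) ≤ #({w | ∃ v ∈ S, H.Adj v w} : Finset W) := by
    refine card_le_card fun w hw => ?_
    simp only [mem_filter, mem_univ, true_and] at hw ⊢
    exact ⟨v, hv, hw⟩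
  have h2 : #S + #({w | H.Adj v w} : Finset W) ≤ Fintype.card W := by
    rw [← card_union_of_disjoint]
    · exact card_le_univ _
    · rw [Finset.disjoint_left]
      intro w hw hvw
      exact hS v hv w hw (mem_filter.1 hvw).2
  have := h v
  omega

open Classical in
/-- Every vertex is adjacent in `R` or in `B` to at least three quarters of the vertices. -/
def HasThreeQuarterDegree (R B : SimpleGraph W) : Prop :=
  ∀ v, 3 * Fintype.card W ≤ 4 * #{w | R.Adj v w ∨ B.Adj v w}

theorem HasThreeQuarterDegree.symm {R B : SimpleGraph W} (h : R.HasThreeQuarterDegree B) :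
    B.HasThreeQuarterDegree R := by
  intro v
  refine (h v).trans_eq ?_
  congr 2
  ext w
  simp [or_comm]

open Classical in
/-- If `R` is connected, a largest component of `B` will do. Let `S` be independent in the union.
If `S` meets the chosen component, then `S` consists of non-neighbours of one vertex and is small.
If `S` meets two other components of `B`, then both `S` and the complement of its neighbourhood are
covered by the non-neighbours of two vertices. If `S` lies in a single component of `B`, this
component has at most half of the vertices, and either all vertices outside of it are neighbours of
`S`, or one of them has no neighbour in `S`, which makes `S` small. -/
theorem exists_perm_of_preconnected [Nonempty W] {R B : SimpleGraph W}
    (h : R.HasThreeQuarterDegree B) (hR : R.Preconnected) :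
    ∃ (r b : W) (σ : Equiv.Perm W), ∀ v, (componentPair R B r b).Adj v (σ v) := by
  obtain ⟨b, -, hb⟩ := exists_max_image (univ : Finset W)
    (fun b => #({w | B.Reachable b w} : Finset W)) univ_nonempty
  refine ⟨b, b, exists_perm_adj_of_hall _ fun S hS => ?_⟩
  set N : Finset W := {w | ∃ v ∈ S, (componentPair R B b b).Adj v w} with hN
  set n := Fintype.card W
  -- `M v` is the set of non-neighbours of `v`, with `v` itself
  set M : W → Finset W := fun v => {w | ¬ (R.Adj v w ∨ B.Adj v w)} with hM
  have hMcard : ∀ v, 4 * #(M v) ≤ n := by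
    intro v
    have h1 := h v
    have h2 := card_filter_add_card_filter_not (s := (univ : Finset W))
      (fun w => R.Adj v w ∨ B.Adj v w)
    rw [card_univ] at h2
    simp only [hM]
    omega
  set C : W → Finset W := fun v => {w | B.Reachable v w} with hC
  have hRN : ∀ v ∈ S, ∀ w, R.Adj v w → w ∈ N := fun v hv w hvw =>
    mem_filter.2 ⟨mem_univ _, v, hv, Or.inl ⟨hvw, hR _ _⟩⟩
  have hindep : ∀ v ∈ S, S \ C v ⊆ M v := by
    intro v hv w hw
    simp only [hC, hM, mem_sdiff, mem_filter, mem_univ, true_and] at hw ⊢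
    rintro (hvw | hvw)
    · exact hS v hv w hw.1 (Or.inl ⟨hvw, hR _ _⟩)
    · exact hw.2 hvw.reachable
  have hout : ∀ v ∈ S, Nᶜ ⊆ M v ∪ C v := by
    intro v hv w hw
    simp only [hC, hM, mem_union, mem_compl, mem_filter, mem_univ, true_and] at hw ⊢
    by_contra hcon
    push Not at hcon
    obtain ⟨hvw | hvw, hcon⟩ := hcon
    · exact hw (hRN v hv w hvw)
    · exact hcon hvw.reachable
  have hcompl := card_add_card_compl N
  change #N + #Nᶜ = n at hcompl
  obtain rfl | ⟨v, hv⟩ := S.eq_empty_or_nonempty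
  · simp
  by_cases hvb : B.Reachable b v
  · have h1 : S ⊆ M v := by
      intro w hw
      simp only [hM, mem_filter, mem_univ, true_and]
      rintro (hvw | hvw)
      · exact hS v hv w hw (Or.inl ⟨hvw, hR _ _⟩)
      · exact hS v hv w hw (Or.inr ⟨hvw, hvb⟩)
    have h2 : Nᶜ ⊆ M v := by
      intro w hw
      simp only [hM, mem_compl, mem_filter, mem_univ, true_and] at hw ⊢
      rintro (hvw | hvw)
      · exact hw (hRN v hv w hvw)
      · exact hw (mem_filter.2 ⟨mem_univ _, v, hv, Or.inr ⟨hvw, hvb⟩⟩)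
    have := card_le_card h1
    have := card_le_card h2
    have := hMcard v
    omega
  -- the component of v has at most half of the vertices
  have hhalf : 2 * #(C v) ≤ n := by
    have h1 : Disjoint (C v) (C b) := by
      rw [Finset.disjoint_left]
      intro w hw hw'
      simp only [hC, mem_filter, mem_univ, true_and] at hw hw'
      exact hvb (hw'.trans hw.symm)
    have h2 := card_le_univ (C v ∪ C b)
    rw [card_union_of_disjoint h1] at h2
    have h3 := hb v (mem_univ _)
    simp only [hC] at h2 ⊢
    omega
  by_cases hSv : S ⊆ C v
  · by_cases hx : ∃ x, x ∉ C v ∧ x ∉ N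
    · obtain ⟨x, hxv, hxN⟩ := hx
      have h1 : S ⊆ M x := by
        intro s hs
        simp only [hM, mem_filter, mem_univ, true_and]
        rintro (hvw | hvw)
        · exact hxN (hRN s hs x hvw.symm)
        · have := hSv hs
          simp only [hC, mem_filter, mem_univ, true_and] at this hxv
          exact hxv (this.trans hvw.symm.reachable)
      have h2 := card_le_card (hout v hv)
      have h3 := card_union_le (M v) (C v)
      have := card_le_card h1
      have := hMcard x
      have := hMcard v
      omega
    · push Not at hx
      have h1 : Nᶜ ⊆ C v := by
        intro x hxN
        by_contra hxv
        exact (mem_compl.1 hxN) (hx x hxv)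
      have := card_le_card h1
      have := card_le_card hSv
      omega
  · obtain ⟨u, hu, huv⟩ := not_subset.1 hSv
    have hdisj : Disjoint (C v) (C u) := by
      rw [Finset.disjoint_left]
      intro w hw hw'
      simp only [hC, mem_filter, mem_univ, true_and] at hw hw' huv
      exact huv (hw.trans hw'.symm)
    have h1 : S ⊆ M v ∪ M u := by
      intro w hw
      by_cases hwv : w ∈ C v
      · exact mem_union_right _ (hindep u hu (mem_sdiff.2 ⟨hw, Finset.disjoint_left.1 hdisj hwv⟩))
      · exact mem_union_left _ (hindep v hv (mem_sdiff.2 ⟨hw, hwv⟩))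
    have h2 : Nᶜ ⊆ M v ∪ M u := by
      intro w hw
      by_cases hwv : w ∈ C v
      · have := (mem_union.1 (hout u hu hw)).resolve_right (Finset.disjoint_left.1 hdisj hwv)
        exact mem_union_right _ this
      · exact mem_union_left _ ((mem_union.1 (hout v hv hw)).resolve_right hwv)
    have := card_le_card h1
    have := card_le_card h2
    have := card_union_le (M v) (M u)
    have := hMcard v
    have := hMcard u
    omega

open Classical in
/-- The vertex set of the component of `v`, as a finset. -/
noncomputable def reachableFinset (G : SimpleGraph W) (v : W) : Finset W := {w | G.Reachable v w}

theorem mem_reachableFinset {G : SimpleGraph W} {v w : W} :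
    w ∈ G.reachableFinset v ↔ G.Reachable v w := by
  simp [reachableFinset]

theorem disjoint_reachableFinset {G : SimpleGraph W} {u v : W} (h : ¬ G.Reachable u v) :
    Disjoint (G.reachableFinset u) (G.reachableFinset v) := by
  rw [Finset.disjoint_left]
  intro w hu hv
  rw [mem_reachableFinset] at hu hv
  exact h (hu.trans hv.symm)

open Classical in
theorem HasThreeQuarterDegree.card_lt {R B : SimpleGraph W} (h : R.HasThreeQuarterDegree B)
    (v : W) :
    3 * Fintype.card W < 4 * #(R.reachableFinset v ∪ B.reachableFinset v) := by
  refine (h v).trans_lt ?_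
  have : ({w | R.Adj v w ∨ B.Adj v w} : Finset W) ⊂
      R.reachableFinset v ∪ B.reachableFinset v := by
    refine (Finset.ssubset_iff_of_subset ?_).2 ⟨v, ?_, ?_⟩
    · intro w hw
      simp only [mem_filter, mem_univ, true_and, mem_union, mem_reachableFinset] at hw ⊢
      exact hw.imp Adj.reachable Adj.reachable
    · simp [mem_reachableFinset]
    · simp
  have := card_lt_card this
  omega

open Classical in
/-- Two vertices that are separated in both graphs: the two crossing intersections of their
components contain more than half of the vertices, because the unions `R`-component ∪ `B`-component
of the two vertices have more than three quarters of the vertices each and overlap only there. -/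
theorem HasThreeQuarterDegree.card_lt_cross {R B : SimpleGraph W} (h : R.HasThreeQuarterDegree B)
    {u v : W} (hR : ¬ R.Reachable u v) (hB : ¬ B.Reachable u v) :
    Fintype.card W < 2 * (#(R.reachableFinset u ∩ B.reachableFinset v) +
      #(R.reachableFinset v ∩ B.reachableFinset u)) := by
  have h1 := h.card_lt u
  have h2 := h.card_lt v
  have h3 := card_union_add_card_inter (R.reachableFinset u ∪ B.reachableFinset u)
    (R.reachableFinset v ∪ B.reachableFinset v)
  have h4 := card_le_univ ((R.reachableFinset u ∪ B.reachableFinset u) ∪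
    (R.reachableFinset v ∪ B.reachableFinset v))
  have h5 : (R.reachableFinset u ∪ B.reachableFinset u) ∩
      (R.reachableFinset v ∪ B.reachableFinset v) ⊆
      (R.reachableFinset u ∩ B.reachableFinset v) ∪
      (R.reachableFinset v ∩ B.reachableFinset u) := by
    intro w hw
    simp only [mem_inter, mem_union, mem_reachableFinset] at hw ⊢
    have h6 : R.Reachable u w → R.Reachable v w → False := fun a b => hR (a.trans b.symm)
    have h7 : B.Reachable u w → B.Reachable v w → False := fun a b => hB (a.trans b.symm)
    tauto
  have h6 := (card_le_card h5).trans (card_union_le _ _)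
  omega

open Classical in
/-- Suppose that the two components of `x` cover everything. A vertex `w` outside the `B`-component
of `x` can have a `B`-neighbour only in the part of the `R`-component of `x` that the `B`-component
misses. This part has less than a quarter of the vertices, as both components of `v` avoid it. -/
theorem HasThreeQuarterDegree.card_le_degree {R B : SimpleGraph W}
    (h : R.HasThreeQuarterDegree B) {x v : W}
    (hcover : ∀ w, R.Reachable x w ∨ B.Reachable x w) (hv : ¬ R.Reachable x v) {w : W}
    (hw : ¬ B.Reachable x w) : Fintype.card W ≤ 2 * #{w' | R.Adj w w'} := by
  have hvB : B.Reachable x v := (hcover v).resolve_left hv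
  have h1 : Disjoint (R.reachableFinset v ∪ B.reachableFinset v)
      (R.reachableFinset x \ B.reachableFinset x) := by
    rw [Finset.disjoint_left]
    intro y hy hy'
    simp only [mem_union, mem_sdiff, mem_reachableFinset] at hy hy'
    obtain hy | hy := hy
    · exact hv (hy'.1.trans hy.symm)
    · exact hy'.2 (hvB.trans hy)
  have h2 := h.card_lt v
  have h3 := card_le_univ ((R.reachableFinset v ∪ B.reachableFinset v) ∪
      (R.reachableFinset x \ B.reachableFinset x))
  rw [card_union_of_disjoint h1] at h3
  have h4 : ({w' | R.Adj w w' ∨ B.Adj w w'} : Finset W) ⊆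
      ({w' | R.Adj w w'} : Finset W) ∪ (R.reachableFinset x \ B.reachableFinset x) := by
    intro y hy
    simp only [mem_filter, mem_univ, true_and, mem_union, mem_sdiff, mem_reachableFinset] at hy ⊢
    obtain hy | hy := hy
    · exact Or.inl hy
    · have : ¬ B.Reachable x y := fun hxy => hw (hxy.trans hy.symm.reachable)
      exact Or.inr ⟨(hcover y).resolve_right this, this⟩
  have h5 := (card_le_card h4).trans (card_union_le _ _)
  have h6 := h w
  omega

/-- A graph and its complement cannot both be disconnected; here in the form that two disconnected
graphs separate a common pair of vertices. -/
theorem exists_not_reachable_pair {R B : SimpleGraph W} (hR : ¬ R.Preconnected)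
    (hB : ¬ B.Preconnected) : ∃ u v, ¬ R.Reachable u v ∧ ¬ B.Reachable u v := by
  by_contra! hcon
  unfold Preconnected at hR hB
  push Not at hR hB
  obtain ⟨u, v, huv⟩ := hR
  obtain ⟨x, y, hxy⟩ := hB
  have hRxy : R.Reachable x y := by
    by_contra h
    exact hxy (hcon _ _ h)
  have key : ∀ z, ¬ R.Reachable x z → False := fun z hz =>
    hxy ((hcon x z hz).trans (hcon y z fun h => hz (hRxy.trans h)).symm)
  by_cases h : R.Reachable x u
  · exact key v fun h' => huv (h.symm.trans h')
  · exact key u h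

open Classical in
/-- If neither graph is connected, some vertex `x` has components in `R` and in `B` that share more
than half of the vertices, and these two components cover everything. All degrees in their union
are then at least half of the number of vertices. -/
theorem exists_perm_of_not_preconnected {R B : SimpleGraph W}
    (h : R.HasThreeQuarterDegree B) (hR : ¬ R.Preconnected) (hB : ¬ B.Preconnected) :
    ∃ (r b : W) (σ : Equiv.Perm W), ∀ v, (componentPair R B r b).Adj v (σ v) := by
  have hx : ∃ x u v, Fintype.card W < 2 * #(R.reachableFinset x ∩ B.reachableFinset x) ∧
      ¬ B.Reachable x u ∧ ¬ R.Reachable x v := by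
    obtain ⟨u, v, hRuv, hBuv⟩ := exists_not_reachable_pair hR hB
    have h1 := h.card_lt_cross hRuv hBuv
    obtain h2 | ⟨x, hx⟩ := (R.reachableFinset u ∩ B.reachableFinset v).eq_empty_or_nonempty
    · rw [h2] at h1
      obtain ⟨y, hy⟩ : (R.reachableFinset v ∩ B.reachableFinset u).Nonempty := by
        rw [← card_pos]
        simp only [card_empty] at h1
        omega
      have hy' := hy
      simp only [mem_inter, mem_reachableFinset] at hy'
      have h3 : R.reachableFinset y ∩ B.reachableFinset y =
          R.reachableFinset v ∩ B.reachableFinset u := by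
        ext z
        simp only [mem_inter, mem_reachableFinset]
        exact and_congr ⟨hy'.1.trans, hy'.1.symm.trans⟩ ⟨hy'.2.trans, hy'.2.symm.trans⟩
      refine ⟨y, v, u, ?_, fun hc => hBuv (hy'.2.trans hc), fun hc => hRuv (hy'.1.trans hc).symm⟩
      rw [h3]
      simpa using h1
    obtain h2 | ⟨y, hy⟩ := (R.reachableFinset v ∩ B.reachableFinset u).eq_empty_or_nonempty
    · rw [h2] at h1
      simp only [mem_inter, mem_reachableFinset] at hx
      have h3 : R.reachableFinset x ∩ B.reachableFinset x =
          R.reachableFinset u ∩ B.reachableFinset v := by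
        ext z
        simp only [mem_inter, mem_reachableFinset]
        exact and_congr ⟨hx.1.trans, hx.1.symm.trans⟩ ⟨hx.2.trans, hx.2.symm.trans⟩
      refine ⟨x, u, v, ?_, fun hc => hBuv (hx.2.trans hc).symm, fun hc => hRuv (hx.1.trans hc)⟩
      rw [h3]
      simpa using h1
    -- Otherwise `x`, `y` are separated in both graphs as well, and the crossing intersections for
    -- `u`, `v` and those for `x`, `y` are disjoint.
    exfalso
    simp only [mem_inter, mem_reachableFinset] at hx hy
    have h2 := h.card_lt_cross (u := x) (v := y)
      (fun hc => hRuv ((hx.1.trans hc).trans hy.1.symm))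
      (fun hc => hBuv ((hx.2.trans hc).trans hy.2.symm).symm)
    have h3 : R.reachableFinset x ∩ B.reachableFinset y ⊆
        R.reachableFinset u ∩ B.reachableFinset u := by
      intro z
      simp only [mem_inter, mem_reachableFinset]
      exact fun hz => ⟨hx.1.trans hz.1, hy.2.trans hz.2⟩
    have h4 : R.reachableFinset y ∩ B.reachableFinset x ⊆
        R.reachableFinset v ∩ B.reachableFinset v := by
      intro z
      simp only [mem_inter, mem_reachableFinset]
      exact fun hz => ⟨hy.1.trans hz.1, hx.2.trans hz.2⟩
    have h5 := card_le_card h3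
    have h6 := card_le_card h4
    have dR := disjoint_reachableFinset hRuv
    have dB := disjoint_reachableFinset hBuv
    have h7 : #(R.reachableFinset u ∩ B.reachableFinset u) +
        #(R.reachableFinset u ∩ B.reachableFinset v) ≤ #(R.reachableFinset u) := by
      rw [← card_union_of_disjoint (dB.mono inter_subset_right inter_subset_right)]
      exact card_le_card (union_subset inter_subset_left inter_subset_left)
    have h8 : #(R.reachableFinset v ∩ B.reachableFinset u) +
        #(R.reachableFinset v ∩ B.reachableFinset v) ≤ #(R.reachableFinset v) := by
      rw [← card_union_of_disjoint (dB.mono inter_subset_right inter_subset_right)]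
      exact card_le_card (union_subset inter_subset_left inter_subset_left)
    have h9 := card_le_univ (R.reachableFinset u ∪ R.reachableFinset v)
    rw [card_union_of_disjoint dR] at h9
    omega
  obtain ⟨x, u, v, hbig, hu, hv⟩ := hx
  have hcover : ∀ w, R.Reachable x w ∨ B.Reachable x w := by
    intro w
    by_contra! hcon
    have h1 := h.card_lt_cross hcon.1 hcon.2
    have dR := disjoint_reachableFinset hcon.1
    have dB := disjoint_reachableFinset hcon.2
    have h7 : #(R.reachableFinset x ∩ B.reachableFinset x) +
        #(R.reachableFinset x ∩ B.reachableFinset w) ≤ #(R.reachableFinset x) := by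
      rw [← card_union_of_disjoint (dB.mono inter_subset_right inter_subset_right)]
      exact card_le_card (union_subset inter_subset_left inter_subset_left)
    have h8 : #(R.reachableFinset w ∩ B.reachableFinset x) ≤ #(R.reachableFinset w) :=
      card_le_card inter_subset_left
    have h9 := card_le_univ (R.reachableFinset x ∪ R.reachableFinset w)
    rw [card_union_of_disjoint dR] at h9
    omega
  refine ⟨x, x, exists_perm_adj_of_degree _ fun w => ?_⟩
  by_cases hwB : B.Reachable x w
  · by_cases hwR : R.Reachable x w
    · have h1 := h w
      have h2 : #({y | R.Adj w y ∨ B.Adj w y} : Finset W) ≤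
          #({y | (componentPair R B x x).Adj w y} : Finset W) := by
        refine card_le_card fun y hy => ?_
        simp only [mem_filter, mem_univ, true_and] at hy ⊢
        exact hy.imp (⟨·, hwR⟩) (⟨·, hwB⟩)
      omega
    · have h1 := h.symm.card_le_degree (fun y => (hcover y).symm) hu hwR
      refine h1.trans (Nat.mul_le_mul_left _ (card_le_card fun y hy => ?_))
      simp only [mem_filter, mem_univ, true_and] at hy ⊢
      exact Or.inr ⟨hy, hwB⟩
  · have h1 := h.card_le_degree hcover hv hwB
    refine h1.trans (Nat.mul_le_mul_left _ (card_le_card fun y hy => ?_))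
    simp only [mem_filter, mem_univ, true_and] at hy ⊢
    exact Or.inl ⟨hy, (hcover w).resolve_right hwB⟩

/-- A two-coloured graph with minimum degree at least three quarters of its order has a component in
each colour such that the union of the two contains a permutation of the vertices along edges, that
is, a perfect fractional matching. -/
theorem HasThreeQuarterDegree.exists_perm [Nonempty W] {R B : SimpleGraph W}
    (h : R.HasThreeQuarterDegree B) :
    ∃ (r b : W) (σ : Equiv.Perm W), ∀ v, (componentPair R B r b).Adj v (σ v) := by
  by_cases hR : R.Preconnected
  · exact exists_perm_of_preconnected h hR
  by_cases hB : B.Preconnected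
  · obtain ⟨r, b, σ, hσ⟩ := exists_perm_of_preconnected h.symm hB
    exact ⟨b, r, σ, by rwa [componentPair_comm] at hσ⟩
  exact exists_perm_of_not_preconnected h hR hB

end SimpleGraph

/-! ### Paths in pairs without holes and connections through a reserve -/

namespace SimpleGraph

/-- There is an edge between any `s` vertices of `X` and any `s` vertices of `Y`. This is all that
is used of a dense regular pair. -/
def IsJoined {V : Type*} (G : SimpleGraph V) (s : ℕ) (X Y : Finset V) : Prop :=
  ∀ X' ⊆ X, ∀ Y' ⊆ Y, s ≤ #X' → s ≤ #Y' → ∃ x ∈ X', ∃ y ∈ Y', G.Adj x y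

theorem Reachable.exists_walk_length {W : Type*} [Fintype W] {Γ : SimpleGraph W} {u v w : W}
    (h : Γ.Reachable u w) (huv : Γ.Adj u v) :
    ∃ p : Γ.Walk u w, 1 ≤ p.length ∧ p.length ≤ Fintype.card W + 1 := by
  classical
  obtain ⟨p, hp⟩ := h.exists_isPath
  by_cases huw : u = w
  · subst huw
    have : 0 < Fintype.card W := Fintype.card_pos_iff.2 ⟨u⟩
    exact ⟨.cons huv (.cons huv.symm .nil), by simp, by simp; omega⟩
  · refine ⟨p, ?_, by have := hp.length_lt; omega⟩
    by_contra! hlt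
    exact huw (Walk.eq_of_length_eq_zero (p := p) (by omega))

variable {V : Type*} [DecidableEq V]

/-- Depth-first search in `G` on the vertex set `Ω`. The list `l` is the current path, `S` the set of
vertices that have been completely explored; no edge joins `S` to the vertices not yet visited.
Every step of the search raises `2 * #S + l.length` by exactly one. -/
theorem exists_depthFirst_state (G : SimpleGraph V) (Ω : Finset V) :
    ∀ j ≤ 2 * #Ω, ∃ (l : List V) (S : Finset V), l.Nodup ∧ l.IsChain G.Adj ∧ (∀ x ∈ l, x ∈ Ω) ∧
      S ⊆ Ω ∧ (∀ x ∈ l, x ∉ S) ∧ (∀ x ∈ S, ∀ y ∈ Ω, y ∉ S → y ∉ l → ¬ G.Adj x y) ∧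
      2 * #S + l.length = j := by
  intro j
  induction j with
  | zero => exact fun _ => ⟨[], ∅, by simp⟩
  | succ j ih =>
    intro hj
    obtain ⟨l, S, hnd, hch, hlΩ, hSΩ, hlS, hST, hcard⟩ := ih (by omega)
    match l with
    | [] =>
      have : #S < #Ω := by simp at hcard; omega
      obtain ⟨t, htΩ, htS⟩ := exists_mem_notMem_of_card_lt_card this
      refine ⟨[t], S, by simp, by simp, by simpa using htΩ, hSΩ, by simpa using htS, ?_, ?_⟩
      · exact fun x hx y hy hyS _ => hST x hx y hy hyS (by simp)
      · simp at hcard ⊢; omega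
    | x :: l =>
      by_cases ht : ∃ t ∈ Ω, t ∉ S ∧ t ∉ x :: l ∧ G.Adj x t
      · obtain ⟨t, htΩ, htS, htl, hxt⟩ := ht
        refine ⟨t :: x :: l, S, List.nodup_cons.2 ⟨htl, hnd⟩,
          List.isChain_cons_cons.2 ⟨hxt.symm, hch⟩, ?_, hSΩ, ?_, ?_, ?_⟩
        · exact List.forall_mem_cons.2 ⟨htΩ, hlΩ⟩
        · exact List.forall_mem_cons.2 ⟨htS, hlS⟩
        · exact fun a ha y hy hyS hyl => hST a ha y hy hyS (List.not_mem_of_not_mem_cons hyl)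
        · simp only [List.length_cons] at hcard ⊢; omega
      · push Not at ht
        have hxS : x ∉ S := hlS x (by simp)
        rw [List.nodup_cons] at hnd
        refine ⟨l, insert x S, hnd.2, hch.of_cons, fun y hy => hlΩ y (by simp [hy]),
          insert_subset (hlΩ x (by simp)) hSΩ, ?_, ?_, ?_⟩
        · intro y hy hyS
          obtain rfl | hyS := mem_insert.1 hyS
          · exact hnd.1 hy
          · exact hlS y (by simp [hy]) hyS
        · intro a ha y hy hyS hyl
          rw [mem_insert, not_or] at hyS
          have hyl' : y ∉ x :: l := by simp [hyS.1, hyl]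
          obtain rfl | ha := mem_insert.1 ha
          · exact ht y hy hyS.2 hyl'
          · exact hST a ha y hy hyS.2 hyl'
        · rw [card_insert_of_notMem hxS]
          simp only [List.length_cons] at hcard
          omega

/-- Along an alternating list, the two kinds of entries are balanced up to one. -/
theorem _root_.List.IsChain.countP_le_countP_not_add_one {α : Type*} {r : α → α → Prop}
    (f : α → Bool) (hr : ∀ x y, r x y → f x ≠ f y) : ∀ {l : List α}, l.IsChain r →
      l.countP f ≤ l.countP (fun x => !f x) + 1
  | [], _ => by simp
  | [x], _ => by
    have := List.countP_le_length (p := f) (l := [x])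
    simp only [List.length_singleton] at this
    omega
  | x :: y :: l, h => by
    rw [List.isChain_cons_cons] at h
    have ih := countP_le_countP_not_add_one f hr h.2.of_cons
    have hxy := hr x y h.1
    simp only [List.countP_cons]
    cases hx : f x <;> cases hy : f y <;> simp_all

/-- A balanced pair without holes has a path that misses at most `4 * s` vertices. Stop a depth-first
search when as many vertices are explored as are unvisited. The path alternates between the two
sides, so the explored vertices in `A` are as many as the unvisited ones in `B`, and vice versa;
since no edges join them, there are fewer than `s` of each. -/
theorem IsJoined.exists_path {G : SimpleGraph V} {s : ℕ} {A B : Finset V} (h : G.IsJoined s A B)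
    (hAB : Disjoint A B) (hcard : #A = #B) : ∃ l : List V, l.Nodup ∧ l.IsChain G.Adj ∧
      (∀ x ∈ l, x ∈ A ∪ B) ∧ 2 * #A ≤ l.length + 4 * s := by
  obtain ⟨l, S, hnd, hch, hlΩ, hSΩ, hlS, hST, hc⟩ :=
    exists_depthFirst_state (G.between A B) (A ∪ B) #(A ∪ B) (by omega)
  refine ⟨l, hnd, hch.imp fun _ _ h => h.1, hlΩ, ?_⟩
  have hΩ : #(A ∪ B) = #A + #B := card_union_of_disjoint hAB
  have halt : ∀ x y, (G.between (A : Set V) B).Adj x y → decide (x ∈ A) ≠ decide (y ∈ A) := by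
    rintro x y ⟨-, ⟨hx, hy⟩ | ⟨hx, hy⟩⟩
    · have : y ∉ A := Finset.disjoint_right.1 hAB (mem_coe.1 hy)
      simp_all
    · have : x ∉ A := Finset.disjoint_right.1 hAB (mem_coe.1 hx)
      simp_all
  have c1 := hch.countP_le_countP_not_add_one _ halt
  have c2 := hch.countP_le_countP_not_add_one (fun x => !decide (x ∈ A))
    (fun x y hxy => by simpa using halt x y hxy)
  simp only [Bool.not_not] at c2
  set L := l.toFinset with hL
  have hLcard : #L = l.length := List.toFinset_card_of_nodup hnd
  have cA : l.countP (fun x => decide (x ∈ A)) = #(A ∩ L) := by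
    rw [List.countP_eq_length_filter, ← List.toFinset_card_of_nodup (hnd.filter _),
      List.toFinset_filter, ← hL]
    congr 1
    ext x
    simp [and_comm]
  have cB : l.countP (fun x => !decide (x ∈ A)) = #(B ∩ L) := by
    rw [List.countP_eq_length_filter, ← List.toFinset_card_of_nodup (hnd.filter _),
      List.toFinset_filter, ← hL]
    congr 1
    ext x
    simp only [mem_filter, mem_inter, hL, List.mem_toFinset]
    constructor
    · rintro ⟨hx, hxA⟩
      have := hlΩ x hx
      simp_all
    · rintro ⟨hxB, hx⟩
      have := Finset.disjoint_right.1 hAB hxB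
      simp_all
  -- `T` is the set of vertices not yet visited
  set T : Finset V := (A ∪ B) \ (S ∪ L) with hT
  have hsplit : ∀ X ⊆ A ∪ B, #(X ∩ S) + #(X ∩ T) + #(X ∩ L) = #X := by
    intro X hX
    have h1 : Disjoint (X ∩ S) (X ∩ T) := by
      rw [Finset.disjoint_left]
      intro x hx hx'
      simp only [hT, mem_inter, mem_sdiff, mem_union] at hx hx'
      tauto
    have h2 : Disjoint (X ∩ S ∪ X ∩ T) (X ∩ L) := by
      rw [Finset.disjoint_left]
      intro x hx hx'
      have := hlS x
      simp only [hT, hL, mem_inter, mem_sdiff, mem_union, List.mem_toFinset] at hx hx'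
      tauto
    rw [← card_union_of_disjoint h1, ← card_union_of_disjoint h2]
    congr 1
    ext x
    have := @hX x
    simp only [hT, mem_inter, mem_sdiff, mem_union] at this ⊢
    tauto
  have hinter : ∀ X ⊆ A ∪ B, #(A ∩ X) + #(B ∩ X) = #X := by
    intro X hX
    rw [← card_union_of_disjoint (hAB.mono inter_subset_left inter_subset_left),
      ← union_inter_distrib_right, inter_eq_right.2 hX]
  have e1 := hsplit A subset_union_left
  have e2 := hsplit B subset_union_right
  have e3 := hinter S hSΩ
  have e4 := hinter T sdiff_subset
  have e5 := hinter L fun x hx => hlΩ x (List.mem_toFinset.1 hx)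
  have hno : ∀ x ∈ S, ∀ y ∈ T, ¬ (G.between (A : Set V) B).Adj x y := by
    intro x hx y hy
    simp only [hT, hL, mem_sdiff, mem_union, List.mem_toFinset, not_or] at hy
    exact hST x hx y (mem_union.2 hy.1) hy.2.1 hy.2.2
  by_contra! hlt
  have hcase : (s ≤ #(A ∩ S) ∧ s ≤ #(B ∩ T)) ∨ (s ≤ #(A ∩ T) ∧ s ≤ #(B ∩ S)) := by omega
  obtain ⟨h1, h2⟩ | ⟨h1, h2⟩ := hcase
  · obtain ⟨x, hx, y, hy, hxy⟩ := h _ inter_subset_left _ inter_subset_left h1 h2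
    rw [mem_inter] at hx hy
    exact hno x hx.2 y hy.2 ⟨hxy, Or.inl ⟨hx.1, hy.1⟩⟩
  · obtain ⟨x, hx, y, hy, hxy⟩ := h _ inter_subset_left _ inter_subset_left h1 h2
    rw [mem_inter] at hx hy
    exact hno y hy.2 x hx.2 ⟨hxy.symm, Or.inr ⟨hy.1, hx.1⟩⟩

/-- A walk in the cluster graph lifts to a walk that starts in a prescribed large set, ends in a
prescribed large set, and has its inner vertices in the reserve `Q`: at each step, more than half of
the reserve in the next cluster has a neighbour in the set reached so far. -/
theorem exists_walk_through_reserve {W : Type*} {Γ : SimpleGraph W} {G : SimpleGraph V} {s : ℕ}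
    {C : W → Finset V} (hΓ : ∀ u w, Γ.Adj u w → G.IsJoined s (C u) (C w)) {Q : Finset V}
    (hQ : ∀ w, 2 * s ≤ #(C w ∩ Q)) {u w : W} (p : Γ.Walk u w) :
    ∀ {X Y : Finset V}, X ⊆ C u → Y ⊆ C w → s ≤ #X → s ≤ #Y → 1 ≤ p.length →
      ∃ x ∈ X, ∃ y ∈ Y, ∃ q : G.Walk x y, q.length = p.length ∧
        ∀ z ∈ q.support, z = x ∨ z = y ∨ z ∈ Q := by
  classical
  induction p with
  | nil => intro X Y _ _ _ _ h; simp at h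
  | @cons u v w huv p ih =>
    intro X Y hX hY hXs hYs _
    cases p with
    | nil =>
      obtain ⟨x, hx, y, hy, hxy⟩ := hΓ _ _ huv X hX Y hY hXs hYs
      refine ⟨x, hx, y, hy, .cons hxy .nil, by simp, by simp⟩
    | cons h' p' =>
      set X' : Finset V := {z ∈ C v ∩ Q | ∃ x ∈ X, G.Adj x z} with hX'
      have hX's : s ≤ #X' := by
        by_contra! hlt
        have h1 := card_filter_add_card_filter_not (s := C v ∩ Q) (fun z => ∃ x ∈ X, G.Adj x z)
        have h2 := hQ v
        rw [← hX'] at h1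
        obtain ⟨x, hx, y, hy, hxy⟩ := hΓ _ _ huv X hX
          {z ∈ C v ∩ Q | ¬ ∃ x ∈ X, G.Adj x z} ((filter_subset _ _).trans inter_subset_left)
          hXs (by omega)
        exact (mem_filter.1 hy).2 ⟨x, hx, hxy⟩
      obtain ⟨x', hx', y, hy, q, hq, hqs⟩ := ih (X := X') (Y := Y)
        ((filter_subset _ _).trans inter_subset_left) hY hX's hYs (by simp)
      rw [hX', mem_filter, mem_inter] at hx'
      obtain ⟨⟨-, hx'Q⟩, x, hx, hxx'⟩ := hx'
      refine ⟨x, hx, y, hy, .cons hxx' q, by simp [hq], fun z hz => ?_⟩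
      rw [Walk.support_cons, List.mem_cons] at hz
      obtain rfl | hz := hz
      · exact Or.inl rfl
      obtain rfl | rfl | hz := hqs z hz
      · exact Or.inr (Or.inr hx'Q)
      · exact Or.inr (Or.inl rfl)
      · exact Or.inr (Or.inr hz)

theorem exists_list_through_reserve {W : Type*} [Fintype W] {Γ : SimpleGraph W}
    {G : SimpleGraph V} {s : ℕ}
    {C : W → Finset V} (hΓ : ∀ u w, Γ.Adj u w → G.IsJoined s (C u) (C w)) {Q : Finset V}
    (hQ : ∀ w, 2 * s ≤ #(C w ∩ Q)) {u v w : W} (huw : Γ.Reachable u w) (huv : Γ.Adj u v)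
    {X Y : Finset V} (hX : X ⊆ C u) (hY : Y ⊆ C w) (hXs : s ≤ #X) (hYs : s ≤ #Y)
    (hXY : Disjoint X Y) :
    ∃ x ∈ X, ∃ y ∈ Y, ∃ K : List V, (x :: (K ++ [y])).IsChain G.Adj ∧ K.Nodup ∧
      (∀ z ∈ K, z ∈ Q) ∧ K.length ≤ Fintype.card W + 1 := by
  classical
  obtain ⟨p, hp1, hp2⟩ := huw.exists_walk_length huv
  obtain ⟨x, hx, y, hy, q, hq, hqs⟩ := exists_walk_through_reserve hΓ hQ p hX hY hXs hYs hp1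
  refine ⟨x, hx, y, hy, ?_⟩
  have hxy : x ≠ y := fun h => Finset.disjoint_left.1 hXY hx (h ▸ hy)
  have hpath := q.bypass_isPath
  have hlen := q.length_bypass_le_length
  have hsub := q.support_bypass_subset_support
  have hchain := q.bypass.isChain_adj_support
  have hnd := hpath.support_nodup
  have hlen' := q.bypass.length_support
  have htail : q.bypass.support.tail ≠ [] := by
    intro h
    have h1 := congrArg List.length h
    rw [List.length_tail, hlen'] at h1
    simp only [Nat.add_sub_cancel, List.length_nil] at h1
    exact hxy (Walk.eq_of_length_eq_zero h1)
  have hsupp : q.bypass.support = x :: (q.bypass.support.tail.dropLast ++ [y]) := by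
    conv_lhs => rw [← Walk.cons_tail_support]
    rw [← List.dropLast_append_getLast htail]
    simp
  refine ⟨q.bypass.support.tail.dropLast, hsupp ▸ hchain, ?_, ?_, ?_⟩
  · exact (hnd.sublist (List.tail_sublist _)).sublist (List.dropLast_sublist _)
  · intro z hz
    rw [hsupp] at hnd hsub
    simp only [List.nodup_cons, List.nodup_append, List.mem_append, List.mem_singleton,
      not_or] at hnd
    obtain rfl | rfl | h := hqs z (hsub (by simp [hz]))
    · exact absurd hz hnd.1.1
    · exact absurd rfl (hnd.2.2.2 _ hz _ rfl)
    · exact h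
  · rw [List.length_dropLast, List.length_tail, hlen']
    omega

end SimpleGraph

/-! ### From connected matchings to cycles -/

namespace SimpleGraph

section Cycle

variable {V : Type*} {G : SimpleGraph V}

theorem exists_walk_support_eq_of_isChain {a y : V} {l : List V}
    (h : (a :: (l ++ [y])).IsChain G.Adj) : ∃ p : G.Walk a y, p.support = a :: (l ++ [y]) := by
  induction l generalizing a with
  | nil => exact ⟨.cons (List.isChain_cons_cons.1 h).1 .nil, by simp⟩
  | cons b l ih =>
    obtain ⟨p, hp⟩ := ih h.of_cons
    exact ⟨.cons (List.isChain_cons_cons.1 h).1 p, by simp [hp]⟩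

theorem exists_isWideCycle_of_isChain {a y : V} {l : List V} (hnd : (a :: (l ++ [y])).Nodup)
    (hch : (y :: a :: (l ++ [y])).IsChain G.Adj) (hl : l ≠ []) :
    ∃ Z : G.Subgraph, Z.IsWideCycle ∧ ∀ z, z ∈ Z.verts ↔ z ∈ a :: (l ++ [y]) := by
  obtain ⟨p, hp⟩ := exists_walk_support_eq_of_isChain hch.of_cons
  have hya : G.Adj y a := (List.isChain_cons_cons.1 hch).1
  have hpath : p.IsPath := by rw [Walk.isPath_def, hp]; exact hnd
  refine ⟨(Walk.cons hya p).toSubgraph, Or.inr (Or.inr (Or.inr ⟨y, _, ?_, rfl⟩)), fun z => ?_⟩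
  · rw [Walk.cons_isCycle_iff]
    refine ⟨hpath, fun hmem => ?_⟩
    cases p with
    | nil => simp at hp
    | @cons _ b _ hab p' =>
      rw [Walk.cons_isPath_iff] at hpath
      rw [Walk.edges_cons, List.mem_cons] at hmem
      obtain h | h := hmem
      · have hyb : y = b := by
          rw [Sym2.eq_iff] at h
          obtain h | h := h
          · exact absurd h.1 hya.ne
          · exact h.1
        subst hyb
        have := Walk.eq_nil_iff_nil.2 (Walk.isPath_iff_nil.1 hpath.1)
        subst this
        simp only [Walk.support_cons, Walk.support_nil, List.cons.injEq, true_and] at hp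
        have h1 := congrArg List.length hp
        have h2 := List.length_pos_iff.2 hl
        simp at h1
        exact hl h1
      · exact hpath.2 (Walk.snd_mem_support_of_mem_edges _ h)
  · rw [Walk.mem_verts_toSubgraph, Walk.support_cons, hp]
    simp
    tauto

end Cycle

variable {V : Type*} [DecidableEq V] {W : Type*}

theorem le_card_inter_sdiff {X Q F : Finset V} {a b : ℕ} (h : a + b ≤ #(X ∩ Q)) (hF : #F ≤ b) :
    a ≤ #(X ∩ (Q \ F)) := by
  have h1 : X ∩ Q ⊆ X ∩ (Q \ F) ∪ F := by
    intro x hx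
    simp only [mem_inter, mem_union, mem_sdiff] at hx ⊢
    tauto
  have h2 := (card_le_card h1).trans (card_union_le _ _)
  omega

/-- A path `H ++ M ++ T` in `G` whose head `H` and tail `T` each contain at least `s` vertices of some
cluster `C w` with `w ∈ D`. This leaves room to shorten the path at both ends when it is joined to
other paths; only the middle part `M` is sure to survive. -/
structure IsSegment (G : SimpleGraph V) (C : W → Finset V) (D : Set W) (s : ℕ)
    (H M T : List V) : Prop where
  nodup : (H ++ M ++ T).Nodup
  isChain : (H ++ M ++ T).IsChain G.Adj
  head : ∃ w ∈ D, s ≤ #{x ∈ C w | x ∈ H}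
  tail : ∃ w ∈ D, s ≤ #{x ∈ C w | x ∈ T}

/-- Of the first `2 * s` vertices of the path in the pair `(A, B)`, at least `s` lie in `A` or at
least `s` lie in `B`; likewise for the last ones. -/
theorem IsJoined.exists_isSegment {G : SimpleGraph V} {C : W → Finset V} {D : Set W} {s : ℕ}
    {A B : Finset V} {a b : W} (h : G.IsJoined s A B) (hAB : Disjoint A B) (hcard : #A = #B)
    (hs : 4 * s < #A) (ha : a ∈ D) (hb : b ∈ D) (hA : A ⊆ C a) (hB : B ⊆ C b) :
    ∃ H M T : List V, G.IsSegment C D s H M T ∧ (∀ x ∈ H ++ M ++ T, x ∈ A ∪ B) ∧ M ≠ [] ∧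
      2 * #A ≤ M.length + 8 * s := by
  obtain ⟨l, hnd, hch, hsub, hlen⟩ := h.exists_path hAB hcard
  have key : ∀ l' : List V, l'.Nodup → (∀ x ∈ l', x ∈ A ∪ B) → l'.length = 2 * s →
      ∃ w ∈ D, s ≤ #{x ∈ C w | x ∈ l'} := by
    intro l' hnd' hsub' hlen'
    have h1 : #l'.toFinset = 2 * s := by rw [List.toFinset_card_of_nodup hnd', hlen']
    have h2 : l'.toFinset ⊆ {x ∈ C a | x ∈ l'} ∪ {x ∈ C b | x ∈ l'} := by
      intro x hx
      rw [List.mem_toFinset] at hx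
      simp only [mem_union, mem_filter, hx, and_true]
      exact (mem_union.1 (hsub' x hx)).imp (@hA x) (@hB x)
    have h3 := (card_le_card h2).trans (card_union_le _ _)
    by_cases h4 : s ≤ #{x ∈ C a | x ∈ l'}
    · exact ⟨a, ha, h4⟩
    · exact ⟨b, hb, by omega⟩
  obtain ⟨H, r, rfl, hH⟩ : ∃ H r, l = H ++ r ∧ H.length = 2 * s :=
    ⟨l.take (2 * s), l.drop (2 * s), (List.take_append_drop _ _).symm,
      by rw [List.length_take]; omega⟩
  rw [List.length_append] at hlen
  obtain ⟨M, T, rfl, hT⟩ : ∃ M T, r = M ++ T ∧ T.length = 2 * s :=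
    ⟨r.take (r.length - 2 * s), r.drop (r.length - 2 * s), (List.take_append_drop _ _).symm,
      by rw [List.length_drop]; omega⟩
  rw [List.length_append] at hlen
  rw [← List.append_assoc] at hnd hch hsub
  refine ⟨H, M, T, ⟨hnd, hch, key H ?_ ?_ hH, key T ?_ ?_ hT⟩, hsub, ?_, by omega⟩
  · exact (List.nodup_append.1 (List.nodup_append.1 hnd).1).1
  · exact fun x hx => hsub x (by simp [hx])
  · exact (List.nodup_append.1 hnd).2.1
  · exact fun x hx => hsub x (by simp [hx])
  · rintro rfl
    simp at hlen
    omega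

variable [Fintype W] {Γ : SimpleGraph W} {G : SimpleGraph V} {C : W → Finset V} {D : Set W} {s : ℕ}

theorem IsSegment.exists_connection (hΓ : ∀ u w, Γ.Adj u w → G.IsJoined s (C u) (C w))
    (hD : ∀ u ∈ D, ∀ w ∈ D, Γ.Reachable u w) (hD' : ∀ u ∈ D, ∃ v, Γ.Adj u v) {Q : Finset V}
    (hQ : ∀ w, 2 * s ≤ #(C w ∩ Q)) {H M T H' M' T' : List V} (h : G.IsSegment C D s H M T)
    (h' : G.IsSegment C D s H' M' T') (hdisj : ∀ x ∈ T, x ∉ H') :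
    ∃ x ∈ T, ∃ y ∈ H', ∃ K : List V, (x :: (K ++ [y])).IsChain G.Adj ∧ K.Nodup ∧
      (∀ z ∈ K, z ∈ Q) ∧ K.length ≤ Fintype.card W + 1 := by
  obtain ⟨u, hu, hus⟩ := h.tail
  obtain ⟨w, hw, hws⟩ := h'.head
  obtain ⟨v, huv⟩ := hD' u hu
  obtain ⟨x, hx, y, hy, K, hK⟩ := exists_list_through_reserve hΓ hQ (hD u hu w hw) huv
    (filter_subset _ _) (filter_subset _ _) hus hws (by
      rw [Finset.disjoint_left]
      intro x hx hx'
      exact hdisj x (mem_filter.1 hx).2 (mem_filter.1 hx').2)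
  exact ⟨x, (mem_filter.1 hx).2, y, (mem_filter.1 hy).2, K, hK⟩

/-- Two disjoint segments can be joined through the reserve, which uses few vertices of it. -/
theorem IsSegment.join (hΓ : ∀ u w, Γ.Adj u w → G.IsJoined s (C u) (C w))
    (hD : ∀ u ∈ D, ∀ w ∈ D, Γ.Reachable u w) (hD' : ∀ u ∈ D, ∃ v, Γ.Adj u v) {Q : Finset V}
    (hQ : ∀ w, 2 * s ≤ #(C w ∩ Q)) {H M T H' M' T' : List V} (h : G.IsSegment C D s H M T)
    (h' : G.IsSegment C D s H' M' T') (hdisj : ∀ x ∈ H ++ M ++ T, x ∉ H' ++ M' ++ T')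
    (hQ₁ : ∀ x ∈ H ++ M ++ T, x ∉ Q) (hQ₂ : ∀ x ∈ H' ++ M' ++ T', x ∉ Q) :
    ∃ M'' K : List V, G.IsSegment C D s H M'' T' ∧ (∀ z ∈ K, z ∈ Q) ∧
      K.length ≤ Fintype.card W + 1 ∧ M.length + M'.length ≤ M''.length ∧
      ∀ z ∈ H ++ M'' ++ T', z ∈ H ++ M ++ T ∨ z ∈ H' ++ M' ++ T' ∨ z ∈ K := by
  obtain ⟨x, hx, y, hy, K, hch, hKnd, hKQ, hKlen⟩ :=
    h.exists_connection hΓ hD hD' hQ h' fun x hx hx' => hdisj x (by simp [hx]) (by simp [hx'])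
  obtain ⟨T₁, T₂, rfl⟩ := List.append_of_mem hx
  obtain ⟨H₁, H₂, rfl⟩ := List.append_of_mem hy
  refine ⟨M ++ T₁ ++ x :: K ++ y :: H₂ ++ M', K, ⟨?_, ?_, h.head, h'.tail⟩, hKQ, hKlen, ?_, ?_⟩
  · have hbig : ((H ++ M ++ (T₁ ++ x :: T₂)) ++ K ++ ((H₁ ++ y :: H₂) ++ M' ++ T')).Nodup := by
      refine List.nodup_append'.2 ⟨List.nodup_append'.2 ⟨h.nodup, hKnd, ?_⟩, h'.nodup, ?_⟩
      · exact fun z hz hzK => hQ₁ z hz (hKQ z hzK)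
      · intro z hz hz'
        obtain hz | hz := List.mem_append.1 hz
        · exact hdisj z hz hz'
        · exact hQ₂ z hz' (hKQ z hz)
    have e1 : (H ++ M ++ (T₁ ++ [x])).Sublist (H ++ M ++ (T₁ ++ x :: T₂)) := by simp
    have e2 : (y :: H₂ ++ M' ++ T').Sublist ((H₁ ++ y :: H₂) ++ M' ++ T') := by simp
    have e3 := (e1.append (List.Sublist.refl K)).append e2
    have := hbig.sublist e3
    simpa using this
  · have c1 : ((H ++ M ++ T₁) ++ [x]).IsChain G.Adj := by
      have := h.isChain
      rw [show H ++ M ++ (T₁ ++ x :: T₂) = ((H ++ M ++ T₁) ++ [x]) ++ T₂ by simp] at this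
      exact this.left_of_append
    have c2 : ([y] ++ (H₂ ++ M' ++ T')).IsChain G.Adj := by
      have := h'.isChain
      rw [show (H₁ ++ y :: H₂) ++ M' ++ T' = H₁ ++ ([y] ++ (H₂ ++ M' ++ T')) by simp] at this
      exact this.right_of_append
    have c3 : ([x] ++ (K ++ [y])).IsChain G.Adj := hch
    have c4 := c1.append_overlap c3 (by simp)
    rw [← List.append_assoc] at c4
    have c5 := c4.append_overlap c2 (by simp)
    simpa using c5
  · simp only [List.length_append, List.length_cons]
    omega
  · intro z hz
    simp only [List.mem_append, List.mem_cons] at hz ⊢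
    tauto

/-- A segment can be closed through the reserve to a cycle that contains its middle part. -/
theorem IsSegment.exists_isWideCycle (hΓ : ∀ u w, Γ.Adj u w → G.IsJoined s (C u) (C w))
    (hD : ∀ u ∈ D, ∀ w ∈ D, Γ.Reachable u w) (hD' : ∀ u ∈ D, ∃ v, Γ.Adj u v) {Q : Finset V}
    (hQ : ∀ w, 2 * s ≤ #(C w ∩ Q)) {H M T : List V} (h : G.IsSegment C D s H M T)
    (hM : M ≠ []) (hQ₁ : ∀ x ∈ H ++ M ++ T, x ∉ Q) :
    ∃ Z : G.Subgraph, Z.IsWideCycle ∧ (∀ z ∈ M, z ∈ Z.verts) ∧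
      ∀ z ∈ Z.verts, z ∈ H ++ M ++ T ∨ z ∈ Q := by
  have hnd := h.nodup
  obtain ⟨x, hx, y, hy, K, hch, hKnd, hKQ, -⟩ := h.exists_connection hΓ hD hD' hQ h
    fun x hx hx' => (List.nodup_append'.1 hnd).2.2 (by simp [hx']) hx
  obtain ⟨T₁, T₂, rfl⟩ := List.append_of_mem hx
  obtain ⟨H₁, H₂, rfl⟩ := List.append_of_mem hy
  -- the cycle, as a list that ends with `y`
  have c1 : ([y] ++ (H₂ ++ M ++ T₁) ++ [x]).IsChain G.Adj := by
    have := h.isChain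
    rw [show (H₁ ++ y :: H₂) ++ M ++ (T₁ ++ x :: T₂) =
      H₁ ++ (([y] ++ (H₂ ++ M ++ T₁) ++ [x]) ++ T₂) by simp] at this
    exact this.right_of_append.left_of_append
  have c3 : ([x] ++ (K ++ [y])).IsChain G.Adj := hch
  have c4 := c1.append_overlap c3 (by simp)
  have hn : ((H₂ ++ M ++ T₁) ++ [x] ++ K ++ [y]).Nodup := by
    have hbig : (((H₁ ++ y :: H₂) ++ M ++ (T₁ ++ x :: T₂)) ++ K).Nodup :=
      List.nodup_append'.2 ⟨hnd, hKnd, fun z hz hzK => hQ₁ z hz (hKQ z hzK)⟩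
    have e1 : (([y] ++ (H₂ ++ M ++ T₁) ++ [x]) ++ K).Sublist
        (((H₁ ++ y :: H₂) ++ M ++ (T₁ ++ x :: T₂)) ++ K) := by
      refine List.Sublist.append ?_ (List.Sublist.refl K)
      simp
    have := hbig.sublist e1
    rw [List.append_assoc [y], List.append_assoc [y]] at this
    exact List.nodup_append_comm.1 this
  obtain ⟨a, l, hal⟩ : ∃ a l, H₂ ++ M ++ T₁ = a :: l := by
    refine List.exists_cons_of_ne_nil ?_
    simp [hM]
  rw [hal] at c4 hn
  obtain ⟨Z, hZ, hZv⟩ := exists_isWideCycle_of_isChain (G := G) (a := a) (y := y)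
    (l := l ++ [x] ++ K) (by simpa using hn) (by simpa using c4) (by simp)
  have hmem : ∀ z, z ∈ Z.verts ↔ z ∈ (H₂ ++ M ++ T₁) ++ [x] ++ K ++ [y] := by
    intro z
    rw [hZv, hal]
    simp
  refine ⟨Z, hZ, fun z hz => (hmem z).2 (by simp [hz]), fun z hz => ?_⟩
  rw [hmem] at hz
  have := hKQ z
  simp only [List.mem_append, List.mem_cons, List.not_mem_nil, or_false] at hz ⊢
  tauto

/-- Disjoint segments can be joined to a single one. The set `F` collects the vertices of the reserve
used on the way. -/
theorem exists_isSegment_of_family {ι : Type*}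
    (hΓ : ∀ u w, Γ.Adj u w → G.IsJoined s (C u) (C w))
    (hD : ∀ u ∈ D, ∀ w ∈ D, Γ.Reachable u w) (hD' : ∀ u ∈ D, ∃ v, Γ.Adj u v) {Q : Finset V}
    {H M T : ι → List V} {I : Finset ι} (hI : I.Nonempty) :
    (∀ i ∈ I, G.IsSegment C D s (H i) (M i) (T i)) →
    (∀ i ∈ I, ∀ j ∈ I, i ≠ j → ∀ x ∈ H i ++ M i ++ T i, x ∉ H j ++ M j ++ T j) →
    (∀ i ∈ I, ∀ x ∈ H i ++ M i ++ T i, x ∉ Q) →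
    (∀ w, 2 * s + #I * (Fintype.card W + 1) ≤ #(C w ∩ Q)) →
    ∃ (H' M' T' : List V) (F : Finset V), G.IsSegment C D s H' M' T' ∧ F ⊆ Q ∧
      #F ≤ #I * (Fintype.card W + 1) ∧ (∑ i ∈ I, (M i).length) ≤ M'.length ∧
      ∀ x ∈ H' ++ M' ++ T', x ∈ F ∨ ∃ i ∈ I, x ∈ H i ++ M i ++ T i := by
  induction hI using Finset.Nonempty.cons_induction with
  | singleton i =>
    intro hseg _ _ _
    exact ⟨H i, M i, T i, ∅, hseg i (by simp), by simp, by simp, by simp, by simp⟩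
  | cons i I hiI hI ih =>
    intro hseg hdisj hQ₁ hQ
    rw [card_cons] at hQ
    obtain ⟨H', M', T', F, hseg', hFQ, hFcard, hlen, hmem⟩ := ih
      (fun j hj => hseg j (mem_cons_of_mem hj))
      (fun j hj k hk => hdisj j (mem_cons_of_mem hj) k (mem_cons_of_mem hk))
      (fun j hj => hQ₁ j (mem_cons_of_mem hj))
      (fun w => le_trans (by gcongr; omega) (hQ w))
    have hQF : ∀ w, 2 * s ≤ #(C w ∩ (Q \ F)) := by
      intro w
      refine le_card_inter_sdiff ((hQ w).trans' ?_) hFcard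
      gcongr
      omega
    obtain ⟨M'', K, hseg'', hKQ, hKlen, hlen'', hmem''⟩ := hseg'.join hΓ hD hD' hQF
      (hseg i (mem_cons_self _ _))
      (by
        intro x hx hxi
        obtain hF | ⟨j, hj, hxj⟩ := hmem x hx
        · exact hQ₁ i (mem_cons_self _ _) x hxi (hFQ hF)
        · exact hdisj j (mem_cons_of_mem hj) i (mem_cons_self _ _)
            (fun h => hiI (h ▸ hj)) x hxj hxi)
      (by
        intro x hx hxQ
        rw [mem_sdiff] at hxQ
        obtain hF | ⟨j, hj, hxj⟩ := hmem x hx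
        · exact hxQ.2 hF
        · exact hQ₁ j (mem_cons_of_mem hj) x hxj hxQ.1)
      (fun x hx hxQ => hQ₁ i (mem_cons_self _ _) x hx (mem_sdiff.1 hxQ).1)
    refine ⟨H', M'', T i, F ∪ K.toFinset, hseg'', ?_, ?_, ?_, ?_⟩
    · refine union_subset hFQ fun x hx => ?_
      exact (mem_sdiff.1 (hKQ x (List.mem_toFinset.1 hx))).1
    · rw [card_cons, add_one_mul]
      have := card_union_le F K.toFinset
      have := List.toFinset_card_le K
      omega
    · rw [sum_cons]
      omega
    · intro x hx
      obtain h | h | h := hmem'' x hx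
      · obtain hF | ⟨j, hj, hxj⟩ := hmem x h
        · exact Or.inl (mem_union_left _ hF)
        · exact Or.inr ⟨j, mem_cons_of_mem hj, hxj⟩
      · exact Or.inr ⟨i, mem_cons_self _ _, h⟩
      · exact Or.inl (mem_union_right _ (List.mem_toFinset.2 h))

/-- A matching inside one component of the cluster graph gives a cycle that covers almost all of the
matched pieces `A i`, `B i`. For an empty matching it is the empty cycle. -/
theorem exists_isWideCycle_of_connected_matching [Fintype V] {ι : Type*}
    (hΓ : ∀ u w, Γ.Adj u w → G.IsJoined s (C u) (C w)) (r : W) {I : Finset ι}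
    {A B : ι → Finset V} {a b : ι → W} (hA : ∀ i ∈ I, A i ⊆ C (a i)) (hB : ∀ i ∈ I, B i ⊆ C (b i))
    (hab : ∀ i ∈ I, Γ.Adj (a i) (b i)) (hr : ∀ i ∈ I, Γ.Reachable r (a i))
    (hcard : ∀ i ∈ I, #(A i) = #(B i)) (hs : ∀ i ∈ I, 4 * s < #(A i))
    (hAB : ∀ i ∈ I, Disjoint (A i) (B i))
    (hdisj : ∀ i ∈ I, ∀ j ∈ I, i ≠ j → Disjoint (A i ∪ B i) (A j ∪ B j))
    {Q : Finset V} (hQ : ∀ w, 2 * s + #I * (Fintype.card W + 1) ≤ #(C w ∩ Q))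
    (hQAB : ∀ i ∈ I, Disjoint (A i ∪ B i) Q) :
    ∃ Z : G.Subgraph, Z.IsWideCycle ∧ (∀ z ∈ Z.verts, z ∈ Q ∨ ∃ i ∈ I, z ∈ A i ∪ B i) ∧
      ∑ i ∈ I, (2 * #(A i)) ≤ Z.verts.ncard + #I * (8 * s) := by
  obtain rfl | hI := I.eq_empty_or_nonempty
  · exact ⟨⊥, Or.inl rfl, by simp, by simp⟩
  set D : Set W := {w | Γ.Reachable r w ∧ ∃ v, Γ.Adj w v} with hDdef
  have hD : ∀ u ∈ D, ∀ w ∈ D, Γ.Reachable u w := fun u hu w hw => hu.1.symm.trans hw.1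
  have hD' : ∀ u ∈ D, ∃ v, Γ.Adj u v := fun u hu => hu.2
  have hex : ∀ i ∈ I, ∃ H M T : List V, G.IsSegment C D s H M T ∧
      (∀ x ∈ H ++ M ++ T, x ∈ A i ∪ B i) ∧ M ≠ [] ∧ 2 * #(A i) ≤ M.length + 8 * s := by
    intro i hi
    refine IsJoined.exists_isSegment (a := a i) (b := b i) ?_ (hAB i hi) (hcard i hi) (hs i hi)
      ⟨hr i hi, _, hab i hi⟩
      ⟨(hr i hi).trans (hab i hi).reachable, _, (hab i hi).symm⟩ (hA i hi) (hB i hi)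
    intro X hX Y hY
    exact hΓ _ _ (hab i hi) X (hX.trans (hA i hi)) Y (hY.trans (hB i hi))
  have hex' : ∀ i, ∃ H M T : List V, i ∈ I → G.IsSegment C D s H M T ∧
      (∀ x ∈ H ++ M ++ T, x ∈ A i ∪ B i) ∧ M ≠ [] ∧ 2 * #(A i) ≤ M.length + 8 * s := by
    intro i
    by_cases hi : i ∈ I
    · obtain ⟨H, M, T, h⟩ := hex i hi
      exact ⟨H, M, T, fun _ => h⟩
    · exact ⟨[], [], [], fun h => absurd h hi⟩
  choose H M T hseg using hex'
  obtain ⟨H', M', T', F, hseg', hFQ, hFcard, hlen, hmem⟩ :=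
    exists_isSegment_of_family (H := H) (M := M) (T := T) hΓ hD hD' hI (fun i hi => (hseg i hi).1)
    (fun i hi j hj hij x hx hx' => Finset.disjoint_left.1 (hdisj i hi j hj hij)
      ((hseg i hi).2.1 x hx) ((hseg j hj).2.1 x hx'))
    (fun i hi x hx => Finset.disjoint_left.1 (hQAB i hi) ((hseg i hi).2.1 x hx)) hQ
  have hQF : ∀ w, 2 * s ≤ #(C w ∩ (Q \ F)) := by
    intro w
    exact le_card_inter_sdiff (hQ w) hFcard
  have hM' : M' ≠ [] := by
    obtain ⟨i, hi⟩ := hI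
    have h1 := List.length_pos_iff.2 (hseg i hi).2.2.1
    have h2 := single_le_sum (f := fun i => (M i).length) (fun _ _ => Nat.zero_le _) hi
    rw [← List.length_pos_iff]
    omega
  obtain ⟨Z, hZ, hMZ, hZmem⟩ := hseg'.exists_isWideCycle hΓ hD hD' hQF hM' (by
    intro x hx hxQ
    rw [mem_sdiff] at hxQ
    obtain hF | ⟨i, hi, hxi⟩ := hmem x hx
    · exact hxQ.2 hF
    · exact Finset.disjoint_left.1 (hQAB i hi) ((hseg i hi).2.1 x hxi) hxQ.1)
  refine ⟨Z, hZ, fun z hz => ?_, ?_⟩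
  · obtain h | h := hZmem z hz
    · obtain hF | ⟨i, hi, hxi⟩ := hmem z h
      · exact Or.inl (hFQ hF)
      · exact Or.inr ⟨i, hi, (hseg i hi).2.1 z hxi⟩
    · exact Or.inl (mem_sdiff.1 h).1
  · have h1 : ∑ i ∈ I, (2 * #(A i)) ≤ ∑ i ∈ I, ((M i).length + 8 * s) :=
      sum_le_sum fun i hi => (hseg i hi).2.2.2
    rw [sum_add_distrib, sum_const, smul_eq_mul] at h1
    have h2 : M'.length ≤ Z.verts.ncard := by
      have hnd : M'.Nodup := (List.nodup_append.1 (List.nodup_append.1 hseg'.nodup).1).2.1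
      rw [← List.toFinset_card_of_nodup hnd, ← Set.ncard_coe_finset]
      refine Set.ncard_le_ncard (fun z hz => hMZ z ?_) (Set.toFinite _)
      simpa using hz
    omega

end SimpleGraph

/-! ### The cluster graph -/

namespace SimpleGraph

open Classical in
/-- Cut every cluster `C w` into two halves and two reserves, one for each colour. The permutation `σ`
matches the first half of `C w` with the second half of `C (σ w)`; the pairs matched in red lie in
one red component and give a red cycle, the others give a blue cycle. -/
theorem exists_disjoint_isWideCycle {V W : Type*} [Fintype V] [Fintype W] {R B : SimpleGraph V}
    {ΓR ΓB : SimpleGraph W} {C : W → Finset V} {s h q : ℕ}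
    (hR : ∀ u w, ΓR.Adj u w → R.IsJoined s (C u) (C w))
    (hB : ∀ u w, ΓB.Adj u w → B.IsJoined s (C u) (C w))
    (hC : ∀ u w, u ≠ w → Disjoint (C u) (C w)) (hcard : ∀ w, 2 * h + 2 * q ≤ #(C w))
    (hq : 2 * s + Fintype.card W * (Fintype.card W + 1) ≤ q) (hs : 4 * s < h) {r b : W}
    {σ : Equiv.Perm W} (hσ : ∀ w, (componentPair ΓR ΓB r b).Adj w (σ w)) :
    ∃ (Z₁ : R.Subgraph) (Z₂ : B.Subgraph), Z₁.IsWideCycle ∧ Z₂.IsWideCycle ∧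
      Disjoint Z₁.verts Z₂.verts ∧
      Fintype.card W * (2 * h) ≤ (Z₁.verts ∪ Z₂.verts).ncard + Fintype.card W * (8 * s) := by
  have hsplit : ∀ w, ∃ A₁ A₂ Q₁ Q₂ : Finset V, A₁ ⊆ C w ∧ A₂ ⊆ C w ∧ Q₁ ⊆ C w ∧ Q₂ ⊆ C w ∧
      #A₁ = h ∧ #A₂ = h ∧ #Q₁ = q ∧ #Q₂ = q ∧ Disjoint A₁ A₂ ∧ Disjoint A₁ Q₁ ∧
      Disjoint A₁ Q₂ ∧ Disjoint A₂ Q₁ ∧ Disjoint A₂ Q₂ ∧ Disjoint Q₁ Q₂ := by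
    intro w
    have hw := hcard w
    obtain ⟨A₁, hA₁, cA₁⟩ := exists_subset_card_eq (s := C w) (n := h) (by omega)
    have c1 := card_sdiff_of_subset hA₁
    obtain ⟨A₂, hA₂, cA₂⟩ := exists_subset_card_eq (s := C w \ A₁) (n := h) (by omega)
    have c2 := card_sdiff_of_subset hA₂
    obtain ⟨Q₁, hQ₁, cQ₁⟩ := exists_subset_card_eq (s := (C w \ A₁) \ A₂) (n := q) (by omega)
    have c3 := card_sdiff_of_subset hQ₁
    obtain ⟨Q₂, hQ₂, cQ₂⟩ := exists_subset_card_eq (s := ((C w \ A₁) \ A₂) \ Q₁) (n := q) (by omega)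
    have s1 : (C w \ A₁) \ A₂ ⊆ C w \ A₁ := sdiff_subset
    have s2 : ((C w \ A₁) \ A₂) \ Q₁ ⊆ (C w \ A₁) \ A₂ := sdiff_subset
    exact ⟨A₁, A₂, Q₁, Q₂, hA₁, hA₂.trans sdiff_subset, (hQ₁.trans s1).trans sdiff_subset,
      ((hQ₂.trans s2).trans s1).trans sdiff_subset, cA₁, cA₂, cQ₁, cQ₂,
      disjoint_sdiff.mono_right hA₂, disjoint_sdiff.mono_right (hQ₁.trans s1),
      disjoint_sdiff.mono_right ((hQ₂.trans s2).trans s1), disjoint_sdiff.mono_right hQ₁,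
      disjoint_sdiff.mono_right (hQ₂.trans s2), disjoint_sdiff.mono_right hQ₂⟩
  choose A₁ A₂ Q₁ Q₂ sA₁ sA₂ sQ₁ sQ₂ cA₁ cA₂ cQ₁ cQ₂ dAA dA₁Q₁ dA₁Q₂ dA₂Q₁ dA₂Q₂ dQQ using hsplit
  -- subsets of distinct clusters are disjoint
  have key : ∀ {f g : W → Finset V}, (∀ w, f w ⊆ C w) → (∀ w, g w ⊆ C w) →
      (∀ w, Disjoint (f w) (g w)) → ∀ u w, Disjoint (f u) (g w) := by
    intro f g hf hg hfg u w
    by_cases huw : u = w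
    · exact huw ▸ hfg u
    · exact (hC u w huw).mono (hf u) (hg w)
  have key' : ∀ {f : W → Finset V}, (∀ w, f w ⊆ C w) → ∀ u w, u ≠ w → Disjoint (f u) (f w) :=
    fun hf u w huw => (hC u w huw).mono (hf u) (hf w)
  have hpair : ∀ i j, i ≠ j → Disjoint (A₁ i ∪ A₂ (σ i)) (A₁ j ∪ A₂ (σ j)) := by
    intro i j hij
    simp only [disjoint_union_left, disjoint_union_right]
    exact ⟨⟨key' sA₁ i j hij, (key sA₁ sA₂ dAA j (σ i)).symm⟩, key sA₁ sA₂ dAA i (σ j),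
      key' sA₂ _ _ (σ.injective.ne hij)⟩
  have hAQ₁ : ∀ i, Disjoint (A₁ i ∪ A₂ (σ i)) (univ.biUnion Q₁) := by
    intro i
    simp only [disjoint_union_left, disjoint_biUnion_right]
    exact fun w _ => ⟨key sA₁ sQ₁ dA₁Q₁ i w, key sA₂ sQ₁ dA₂Q₁ _ w⟩
  have hAQ₂ : ∀ i, Disjoint (A₁ i ∪ A₂ (σ i)) (univ.biUnion Q₂) := by
    intro i
    simp only [disjoint_union_left, disjoint_biUnion_right]
    exact fun w _ => ⟨key sA₁ sQ₂ dA₁Q₂ i w, key sA₂ sQ₂ dA₂Q₂ _ w⟩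
  have hQQ : Disjoint (univ.biUnion Q₁) (univ.biUnion Q₂) := by
    simp only [disjoint_biUnion_left, disjoint_biUnion_right]
    exact fun w _ u _ => key sQ₁ sQ₂ dQQ u w
  set I : Finset W := {w | ΓR.Adj w (σ w) ∧ ΓR.Reachable r w} with hI
  have hQcard : ∀ {Q : W → Finset V}, (∀ w, Q w ⊆ C w) → (∀ w, #(Q w) = q) → ∀ J : Finset W,
      ∀ w, 2 * s + #J * (Fintype.card W + 1) ≤ #(C w ∩ univ.biUnion Q) := by
    intro Q hQ hQq J w
    have h1 : Q w ⊆ C w ∩ univ.biUnion Q :=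
      subset_inter (hQ w) (subset_biUnion_of_mem Q (mem_univ w))
    have h2 := card_le_card h1
    have h3 : #J * (Fintype.card W + 1) ≤ Fintype.card W * (Fintype.card W + 1) := by
      gcongr
      exact card_le_univ J
    rw [hQq] at h2
    omega
  have hBσ : ∀ w ∈ Iᶜ, ΓB.Adj w (σ w) ∧ ΓB.Reachable b w := by
    intro w hw
    refine (hσ w).resolve_left fun h => mem_compl.1 hw ?_
    simpa [hI] using h
  have hRσ : ∀ w ∈ I, ΓR.Adj w (σ w) ∧ ΓR.Reachable r w := fun w hw => by simpa [hI] using hw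
  obtain ⟨Z₁, hZ₁, hZ₁v, hZ₁c⟩ := exists_isWideCycle_of_connected_matching hR r (I := I)
    (A := A₁) (B := fun i => A₂ (σ i)) (a := id) (b := σ) (fun i _ => sA₁ i) (fun i _ => sA₂ _)
    (fun i hi => (hRσ i hi).1) (fun i hi => (hRσ i hi).2) (fun i _ => by rw [cA₁, cA₂])
    (fun i _ => by rw [cA₁]; exact hs) (fun i _ => key sA₁ sA₂ dAA i _)
    (fun i _ j _ hij => hpair i j hij) (hQcard sQ₁ cQ₁ I) (fun i _ => hAQ₁ i)
  obtain ⟨Z₂, hZ₂, hZ₂v, hZ₂c⟩ := exists_isWideCycle_of_connected_matching hB b (I := Iᶜ)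
    (A := A₁) (B := fun i => A₂ (σ i)) (a := id) (b := σ) (fun i _ => sA₁ i) (fun i _ => sA₂ _)
    (fun i hi => (hBσ i hi).1) (fun i hi => (hBσ i hi).2) (fun i _ => by rw [cA₁, cA₂])
    (fun i _ => by rw [cA₁]; exact hs) (fun i _ => key sA₁ sA₂ dAA i _)
    (fun i _ j _ hij => hpair i j hij) (hQcard sQ₂ cQ₂ Iᶜ) (fun i _ => hAQ₂ i)
  have hdisj : Disjoint Z₁.verts Z₂.verts := by
    rw [Set.disjoint_left]
    intro z hz hz'
    obtain h1 | ⟨i, hi, h1⟩ := hZ₁v z hz <;> obtain h2 | ⟨j, hj, h2⟩ := hZ₂v z hz'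
    · exact Finset.disjoint_left.1 hQQ h1 h2
    · exact Finset.disjoint_left.1 (hAQ₁ j) h2 h1
    · exact Finset.disjoint_left.1 (hAQ₂ i) h1 h2
    · exact Finset.disjoint_left.1 (hpair i j fun hij => mem_compl.1 hj (hij ▸ hi)) h1 h2
  refine ⟨Z₁, Z₂, hZ₁, hZ₂, hdisj, ?_⟩
  rw [Set.ncard_union_eq hdisj (Set.toFinite _) (Set.toFinite _)]
  simp only [cA₁, sum_const, smul_eq_mul] at hZ₁c hZ₂c
  have hIc := card_add_card_compl I
  have e1 : Fintype.card W * (2 * h) = #I * (2 * h) + #Iᶜ * (2 * h) := by rw [← hIc, add_mul]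
  have e2 : Fintype.card W * (8 * s) = #I * (8 * s) + #Iᶜ * (8 * s) := by rw [← hIc, add_mul]
  omega

section Reduced

variable {V : Type*} (G : SimpleGraph V) [DecidableRel G.Adj]

/-- The graph on sets of vertices in which two sets are adjacent if they form an `ε`-uniform pair of
density at least `2 * ε`. -/
def clusterGraph (ε : ℝ) : SimpleGraph (Finset V) where
  Adj U W := U ≠ W ∧ G.IsUniform ε U W ∧ 2 * ε ≤ G.edgeDensity U W
  symm := ⟨fun _ _ h => ⟨h.1.symm, h.2.1.symm, by rw [edgeDensity_comm]; exact h.2.2⟩⟩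
  loopless := ⟨fun _ h => h.1 rfl⟩

variable {G}

theorem isJoined_of_clusterGraph_adj {ε : ℝ} {s : ℕ} {U W : Finset V}
    (h : (G.clusterGraph ε).Adj U W) (hU : ε * #U ≤ s) (hW : ε * #W ≤ s) : G.IsJoined s U W := by
  intro X hX Y hY hXs hYs
  have hX' : (s : ℝ) ≤ #X := by exact_mod_cast hXs
  have hY' : (s : ℝ) ≤ #Y := by exact_mod_cast hYs
  have h1 := h.2.1 hX hY (by linarith) (by linarith)
  have h2 := h.2.2
  have h3 := h.2.1.pos
  rw [abs_lt] at h1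
  have h4 : (0 : ℝ) < G.edgeDensity X Y := by linarith
  by_contra! hcon
  have h5 : G.interedges X Y = ∅ := by
    rw [eq_empty_iff_forall_notMem]
    rintro ⟨x, y⟩ hxy
    rw [mem_interedges_iff] at hxy
    exact hcon x hxy.1 y hxy.2.1 hxy.2.2
  rw [edgeDensity_def, h5] at h4
  simp at h4

variable [Fintype V] [DecidableEq V]

open Classical in
/-- The parts of `P` that do not form an `ε`-uniform pair with `U` in both graphs. -/
noncomputable def irregularParts (R B : SimpleGraph V) (P : Finpartition (univ : Finset V)) (ε : ℝ)
    (U : Finset V) : Finset (Finset V) :=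
  {X ∈ P.parts | U ≠ X ∧ ¬ (R.IsUniform ε U X ∧ B.IsUniform ε U X)}

open Classical in
/-- If each vertex of a part `U` has at least `D` neighbours, then `D` is bounded by the vertices in
`U` itself, in parts irregular to `U` and in neighbours of `U` in the cluster graphs, plus `4 * ε`
times the number of vertices for the sparse pairs, which have density at most `2 * ε` per graph. -/
theorem le_card_clusterGraph_neighbors {R B : SimpleGraph V} {P : Finpartition (univ : Finset V)}
    {ε D c : ℝ} (hε : 0 ≤ ε) (hc : ∀ X ∈ P.parts, (#X : ℝ) ≤ c) {U : Finset V} (hU : U ∈ P.parts)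
    (hD : ∀ u ∈ U, D ≤ #{w | R.Adj u w ∨ B.Adj u w}) :
    D ≤ c * (1 + #(irregularParts R B P ε U) +
      #{X ∈ P.parts | (R.clusterGraph ε).Adj U X ∨ (B.clusterGraph ε).Adj U X}) +
        4 * ε * Fintype.card V := by
  set N := irregularParts R B P ε U with hN
  set T := {X ∈ P.parts | (R.clusterGraph ε).Adj U X ∨ (B.clusterGraph ε).Adj U X} with hT
  have hUpos : (0 : ℝ) < #U := by exact_mod_cast (P.nonempty_of_mem_parts hU).card_pos
  have hc0 : 0 ≤ c := (Nat.cast_nonneg _).trans (hc U hU)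
  have hdeg : ∀ u, #{w | R.Adj u w ∨ B.Adj u w} =
      ∑ X ∈ P.parts, #{w ∈ X | R.Adj u w ∨ B.Adj u w} := by
    intro u
    rw [← card_biUnion]
    · rw [← filter_biUnion, ← sup_eq_biUnion]
      exact congrArg (fun Y : Finset V => #{w ∈ Y | R.Adj u w ∨ B.Adj u w}) P.sup_parts.symm
    · intro X hX Y hY hXY
      exact (P.disjoint hX hY hXY).mono (filter_subset _ _) (filter_subset _ _)
  have hedge : ∀ X ∈ P.parts, (∑ u ∈ U, #{w ∈ X | R.Adj u w ∨ B.Adj u w} : ℝ) ≤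
      (if X ∈ insert U (N ∪ T) then #U * c else 0) + 4 * ε * #U * #X := by
    intro X hX
    have hXpos : (0 : ℝ) < #X := by exact_mod_cast (P.nonempty_of_mem_parts hX).card_pos
    split_ifs with h
    · have h1 : (∑ u ∈ U, (#{w ∈ X | R.Adj u w ∨ B.Adj u w} : ℝ)) ≤ #U * c := by
        rw [← nsmul_eq_mul]
        refine sum_le_card_nsmul _ _ _ fun u _ => le_trans ?_ (hc X hX)
        exact_mod_cast card_filter_le _ _
      have : 0 ≤ 4 * ε * #U * #X := by positivity
      linarith
    · have hXU : U ≠ X := fun h' => h (by simp [h'])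
      have hXN : X ∉ N := fun h' => h (by simp [h'])
      have hXT : X ∉ T := fun h' => h (by simp [h'])
      obtain ⟨uR, uB⟩ : R.IsUniform ε U X ∧ B.IsUniform ε U X := by
        by_contra hcon
        exact hXN (mem_filter.2 ⟨hX, hXU, hcon⟩)
      have dR : (R.edgeDensity U X : ℝ) < 2 * ε := by
        by_contra! hcon
        exact hXT (mem_filter.2 ⟨hX, Or.inl ⟨hXU, uR, hcon⟩⟩)
      have dB : (B.edgeDensity U X : ℝ) < 2 * ε := by
        by_contra! hcon
        exact hXT (mem_filter.2 ⟨hX, Or.inr ⟨hXU, uB, hcon⟩⟩)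
      have hsum : ∀ H : SimpleGraph V, ((∑ u ∈ U, #{w ∈ X | H.Adj u w} : ℕ) : ℝ) =
          H.edgeDensity U X * (#U * #X) := by
        intro H
        rw [edgeDensity_def]
        push_cast
        rw [div_mul_cancel₀ _ (by positivity)]
        norm_cast
        rw [interedges_def, card_filter, sum_product]
        refine sum_congr rfl fun u _ => ?_
        rw [card_filter]
      have hle : ∑ u ∈ U, #{w ∈ X | R.Adj u w ∨ B.Adj u w} ≤
          ∑ u ∈ U, #{w ∈ X | R.Adj u w} + ∑ u ∈ U, #{w ∈ X | B.Adj u w} := by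
        rw [← sum_add_distrib]
        refine sum_le_sum fun u _ => ?_
        rw [filter_or]
        exact card_union_le _ _
      have hle' : ((∑ u ∈ U, #{w ∈ X | R.Adj u w ∨ B.Adj u w} : ℕ) : ℝ) ≤
          R.edgeDensity U X * (#U * #X) + B.edgeDensity U X * (#U * #X) := by
        rw [← hsum, ← hsum]
        exact_mod_cast hle
      rw [Nat.cast_sum] at hle'
      have h1 := mul_le_mul_of_nonneg_right dR.le (mul_pos hUpos hXpos).le
      have h2 := mul_le_mul_of_nonneg_right dB.le (mul_pos hUpos hXpos).le
      linarith
  have htotal : #U * D ≤ #U * (c * (1 + #N + #T) + 4 * ε * Fintype.card V) := by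
    calc #U * D ≤ ∑ u ∈ U, (#{w | R.Adj u w ∨ B.Adj u w} : ℝ) := by
          rw [← nsmul_eq_mul]
          exact card_nsmul_le_sum _ _ _ hD
      _ = ∑ X ∈ P.parts, ∑ u ∈ U, (#{w ∈ X | R.Adj u w ∨ B.Adj u w} : ℝ) := by
          rw [sum_comm]
          refine sum_congr rfl fun u _ => ?_
          rw [hdeg]
          push_cast
          rfl
      _ ≤ ∑ X ∈ P.parts, ((if X ∈ insert U (N ∪ T) then #U * c else 0) + 4 * ε * #U * #X) :=
          sum_le_sum hedge
      _ ≤ #(insert U (N ∪ T)) * (#U * c) + 4 * ε * #U * Fintype.card V := by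
          rw [sum_add_distrib, ← mul_sum, ← sum_filter, sum_const, nsmul_eq_mul]
          have h1 : (∑ X ∈ P.parts, (#X : ℝ)) = Fintype.card V := by
            rw [← card_univ, ← P.sum_card_parts]
            push_cast
            rfl
          rw [h1]
          gcongr
          exact fun X hX => (mem_filter.1 hX).2
      _ ≤ (1 + #N + #T) * (#U * c) + 4 * ε * #U * Fintype.card V := by
          gcongr
          have h1 := card_insert_le U (N ∪ T)
          have h2 := card_union_le N T
          have : #(insert U (N ∪ T)) ≤ 1 + #N + #T := by omega
          exact_mod_cast this
      _ = _ := by ring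
  exact le_of_mul_le_mul_left htotal hUpos

open Classical in
/-- Few parts are in many irregular pairs. -/
theorem card_irregular_le {R B : SimpleGraph V} {P : Finpartition (univ : Finset V)} {θ : ℝ}
    (hθ : 0 < θ) (hR : P.IsUniform R (θ ^ 2)) (hB : P.IsUniform B (θ ^ 2)) :
    (#{U ∈ P.parts | θ * #P.parts < #(irregularParts R B P (θ ^ 2) U)} : ℝ) ≤
      2 * θ * #P.parts := by
  set k := #P.parts with hk
  set bad := {U ∈ P.parts | θ * k < #(irregularParts R B P (θ ^ 2) U)} with hbad
  obtain hk0 | hk0 := Nat.eq_zero_or_pos k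
  · have : bad = ∅ := by
      rw [hbad, card_eq_zero.1 (hk.symm.trans hk0)]
      simp
    rw [this]
    simp [hk0]
  have hk' : (0 : ℝ) < k := by exact_mod_cast hk0
  have h1 : ∑ U ∈ P.parts, #(irregularParts R B P (θ ^ 2) U) ≤
      #(P.nonUniforms R (θ ^ 2)) + #(P.nonUniforms B (θ ^ 2)) := by
    have : ∑ U ∈ P.parts, #(irregularParts R B P (θ ^ 2) U) =
        #(P.parts.sigma fun U => irregularParts R B P (θ ^ 2) U) := (card_sigma _ _).symm
    rw [this]
    refine le_trans ?_ (card_union_le _ _)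
    refine card_le_card_of_injOn (fun x => (x.1, x.2)) ?_ ?_
    · rintro ⟨U, X⟩ hx
      simp only [coe_sigma, Set.mem_sigma_iff, mem_coe, irregularParts, mem_filter] at hx
      simp only [coe_union, Set.mem_union, mem_coe, Finpartition.mk_mem_nonUniforms]
      tauto
    · rintro ⟨U, X⟩ _ ⟨U', X'⟩ _ h
      simpa using h
  have h2 : ∀ H : SimpleGraph V, P.IsUniform H (θ ^ 2) →
      (#(P.nonUniforms H (θ ^ 2)) : ℝ) ≤ k ^ 2 * θ ^ 2 := by
    intro H hH
    refine le_trans hH ?_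
    gcongr
    rw [← hk]
    have : k * (k - 1) ≤ k ^ 2 := by rw [sq]; gcongr; omega
    exact_mod_cast this
  have h3 : (#bad : ℝ) * (θ * k) ≤ ∑ U ∈ P.parts, (#(irregularParts R B P (θ ^ 2) U) : ℝ) := by
    rw [← nsmul_eq_mul]
    refine (card_nsmul_le_sum bad _ _ fun U hU => (mem_filter.1 hU).2.le).trans ?_
    exact sum_le_sum_of_subset_of_nonneg (filter_subset _ _) fun _ _ _ => Nat.cast_nonneg _
  have h4 : (∑ U ∈ P.parts, (#(irregularParts R B P (θ ^ 2) U) : ℝ)) ≤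
      k ^ 2 * θ ^ 2 + k ^ 2 * θ ^ 2 := by
    refine le_trans ?_ (add_le_add (h2 R hR) (h2 B hB))
    exact_mod_cast h1
  have h5 : (#bad : ℝ) * (θ * k) ≤ (2 * θ * k) * (θ * k) := by
    refine h3.trans (h4.trans_eq ?_)
    ring
  exact le_of_mul_le_mul_right h5 (by positivity)

end Reduced

end SimpleGraph

/-! ### The two cycles -/

namespace SimpleGraph

/-- The arithmetic that turns `le_card_clusterGraph_neighbors` into a lower bound on the number `t` of
neighbours of a part; the summand `2 * θ * k` pays for the discarded parts. -/
theorem le_clusterGraph_degree_of_le {θ k m n t : ℝ} (hθ : 0 < θ) (hθ₁ : θ ≤ 1 / 240) (hm : 0 < m)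
    (hk : 0 < k) (hmk : m * k ≤ n) (hθk : 1 ≤ θ * k) (hθm : 1 ≤ θ * m)
    (h : (3 / 4 + 60 * θ) * n ≤ (m + 1) * (1 + θ * k + t) + 4 * θ ^ 2 * n) :
    3 / 4 * k + 2 * θ * k ≤ t := by
  by_contra! hlt
  have h1 : (m + 1) * (1 + θ * k + t) < m * (1 + θ) * (k * (3 / 4 + 4 * θ)) :=
    calc (m + 1) * (1 + θ * k + t) < (m + 1) * (k * (3 / 4 + 4 * θ)) := by
          refine mul_lt_mul_of_pos_left ?_ (by linarith)
          linarith
      _ ≤ _ := by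
          refine mul_le_mul_of_nonneg_right ?_ (by positivity)
          linarith
  have h2 : (3 / 4 + 60 * θ - 4 * θ ^ 2) * (m * k) ≤ (3 / 4 + 60 * θ - 4 * θ ^ 2) * n :=
    mul_le_mul_of_nonneg_left hmk (by nlinarith)
  have h3 : (1 + θ) * (3 / 4 + 4 * θ) ≤ 3 / 4 + 60 * θ - 4 * θ ^ 2 := by nlinarith
  have h4 := mul_le_mul_of_nonneg_right h3 (mul_pos hm hk).le
  linarith

/-- The arithmetic of the final count: of `k` parts, `w` are kept, and the cycles cover `x` vertices
for each of them. -/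
theorem le_coverage_of_le {θ k m n w x z : ℝ} (hθ : 0 < θ) (hθ₁ : θ ≤ 1 / 240) (hm : 0 < m)
    (hk : 0 < k) (hn : n ≤ k * (m + 1)) (hθm : 1 ≤ θ * m) (hw : k * (1 - 2 * θ) ≤ w)
    (hx : m * (1 - 13 * θ ^ 2) ≤ x) (h : w * x ≤ z) : (1 - 60 * θ) * n ≤ z := by
  have h0 : 0 ≤ 1 - 13 * θ ^ 2 := by nlinarith
  have h1 : (1 - 60 * θ) * n ≤ (1 - 60 * θ) * (k * (m * (1 + θ))) := by
    refine mul_le_mul_of_nonneg_left (hn.trans ?_) (by linarith)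
    refine mul_le_mul_of_nonneg_left ?_ hk.le
    linarith
  have h2 : (k * (1 - 2 * θ)) * (m * (1 - 13 * θ ^ 2)) ≤ w * x :=
    mul_le_mul hw hx (by positivity) ((mul_nonneg hk.le (by linarith)).trans hw)
  have h3 : (1 - 60 * θ) * (1 + θ) ≤ (1 - 2 * θ) * (1 - 13 * θ ^ 2) := by nlinarith [pow_pos hθ 3]
  have h4 := mul_le_mul_of_nonneg_right h3 (mul_pos hm hk).le
  linarith

open Classical in
/-- The statement for a graph with an equipartition that is uniform in both colours, into parts that
are large compared to their number. The cluster graph is taken on the parts that are in few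
irregular pairs; it inherits the minimum degree condition. -/
theorem exists_wideCycles_of_isUniform {V : Type*} [Fintype V] {R B : SimpleGraph V}
    {P : Finpartition (univ : Finset V)} (hP : P.IsEquipartition) {θ : ℝ} (hθ : 0 < θ)
    (hθ₁ : θ ≤ 1 / 240) (hR : P.IsUniform R (θ ^ 2)) (hB : P.IsUniform B (θ ^ 2))
    (hk : 1 ≤ θ * #P.parts)
    (hm : 14 + 2 * ((#P.parts : ℝ) * (#P.parts + 1)) ≤
      θ ^ 2 * (Fintype.card V / #P.parts : ℕ))
    (hdeg : ∀ u, (3 / 4 + 60 * θ) * (Fintype.card V : ℝ) ≤ #{w | R.Adj u w ∨ B.Adj u w}) :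
    ∃ (Z₁ : R.Subgraph) (Z₂ : B.Subgraph), Z₁.IsWideCycle ∧ Z₂.IsWideCycle ∧
      Disjoint Z₁.verts Z₂.verts ∧
      (1 - 60 * θ) * (Fintype.card V : ℝ) ≤ (Z₁.verts ∪ Z₂.verts).ncard := by
  obtain ⟨n, hn⟩ : ∃ n, n = Fintype.card V := ⟨_, rfl⟩
  obtain ⟨k, hkdef⟩ : ∃ k, k = #P.parts := ⟨_, rfl⟩
  obtain ⟨m, hmdef⟩ : ∃ m, m = n / k := ⟨_, rfl⟩
  rw [← hkdef] at hk
  rw [← hkdef, ← hn, ← hmdef] at hm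
  rw [← hn] at hdeg ⊢
  have hθθ : θ ^ 2 ≤ θ := by nlinarith
  have hk0 : (0 : ℝ) < k := by
    by_contra! hcon
    nlinarith
  have hk0' : 0 < k := by exact_mod_cast hk0
  have hm14 : (14 : ℝ) ≤ θ ^ 2 * m := le_trans (by nlinarith) hm
  have hm0 : (0 : ℝ) < m := by
    by_contra! hcon
    have : θ ^ 2 * (m : ℝ) ≤ 0 := mul_nonpos_of_nonneg_of_nonpos (by positivity) hcon
    linarith
  have hθm : 1 ≤ θ * m := by
    have : θ ^ 2 * m ≤ θ * m := mul_le_mul_of_nonneg_right hθθ hm0.le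
    linarith
  have hmk : (m : ℝ) * k ≤ n := by
    have : m * k ≤ n := hmdef ▸ Nat.div_mul_le_self n k
    exact_mod_cast this
  have hnk : (n : ℝ) ≤ k * (m + 1) := by
    have : n ≤ k * (m + 1) := hmdef ▸ (Nat.lt_mul_div_succ n hk0').le
    exact_mod_cast this
  have hpart₁ : ∀ X ∈ P.parts, m ≤ #X := fun X hX => by
    have := hP.average_le_card_part hX
    rwa [card_univ, ← hn, ← hkdef, ← hmdef] at this
  have hpart₂ : ∀ X ∈ P.parts, #X ≤ m + 1 := fun X hX => by
    have := hP.card_part_le_average_add_one hX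
    rwa [card_univ, ← hn, ← hkdef, ← hmdef] at this
  set bad := {U ∈ P.parts | θ * #P.parts < #(irregularParts R B P (θ ^ 2) U)} with hbad
  have hbadcard : (#bad : ℝ) ≤ 2 * θ * k := hkdef ▸ card_irregular_le hθ hR hB
  set good := P.parts \ bad with hgood
  have hgoodcard : #good + #bad = k := by
    rw [hkdef]
    exact card_sdiff_add_card_eq_card (filter_subset _ _)
  have hgoodcard' : (#good : ℝ) + #bad = k := by exact_mod_cast hgoodcard
  set ΓR : SimpleGraph good := (R.clusterGraph (θ ^ 2)).comap Subtype.val with hΓR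
  set ΓB : SimpleGraph good := (B.clusterGraph (θ ^ 2)).comap Subtype.val with hΓB
  have hcardW : Fintype.card good = #good := Fintype.card_coe good
  have hdegΓ : ΓR.HasThreeQuarterDegree ΓB := by
    intro U
    have hU := U.2
    simp only [hgood, hbad, mem_sdiff, mem_filter, not_and, not_lt] at hU
    have hUirr : (#(irregularParts R B P (θ ^ 2) U.1) : ℝ) ≤ θ * k := hkdef ▸ hU.2 hU.1
    set T := {X ∈ P.parts | (R.clusterGraph (θ ^ 2)).Adj U X ∨ (B.clusterGraph (θ ^ 2)).Adj U X}
      with hT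
    have h1 := le_card_clusterGraph_neighbors (R := R) (B := B) (P := P) (ε := θ ^ 2)
      (c := m + 1) (D := (3 / 4 + 60 * θ) * n) (by positivity)
      (fun X hX => by exact_mod_cast hpart₂ X hX) hU.1 (fun u _ => hdeg u)
    rw [← hn] at h1
    have h2 : (3 / 4 + 60 * θ) * (n : ℝ) ≤ (m + 1) * (1 + θ * k + #T) + 4 * θ ^ 2 * n := by
      refine h1.trans ?_
      gcongr
    have h3 := le_clusterGraph_degree_of_le hθ hθ₁ hm0 hk0 hmk hk hθm h2
    have h4 : T ⊆ bad ∪ ({w | ΓR.Adj U w ∨ ΓB.Adj U w} : Finset good).map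
        (Function.Embedding.subtype _) := by
      intro X hX
      rw [hT, mem_filter] at hX
      by_cases hXb : X ∈ bad
      · exact mem_union_left _ hXb
      · refine mem_union_right _ (mem_map.2 ⟨⟨X, mem_sdiff.2 ⟨hX.1, hXb⟩⟩, ?_, rfl⟩)
        simpa [hΓR, hΓB] using hX.2
    have h5 := (card_le_card h4).trans (card_union_le _ _)
    rw [card_map] at h5
    have h6 : (#T : ℝ) ≤ #bad + #({w | ΓR.Adj U w ∨ ΓB.Adj U w} : Finset good) := by
      exact_mod_cast h5
    rw [hcardW]
    have h7 : (3 * #good : ℝ) ≤ 4 * #({w | ΓR.Adj U w ∨ ΓB.Adj U w} : Finset good) := by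
      have : (0 : ℝ) ≤ #bad := Nat.cast_nonneg _
      linarith
    exact_mod_cast h7
  have hgood0 : (0 : ℝ) < #good := by nlinarith
  have : Nonempty good := by
    rw [nonempty_coe_sort, ← card_pos]
    exact_mod_cast hgood0
  obtain ⟨r, b, σ, hσ⟩ := hdegΓ.exists_perm
  -- `s` is the size above which uniformity applies, `q` the size of a reserve, which must also allow
  -- for `k + 1` vertices used up in each of the at most `k` connections, and `h` that of a half
  set s := ⌈θ ^ 2 * (m + 1)⌉₊ with hs
  have hs₁ : θ ^ 2 * (m + 1) ≤ s := Nat.le_ceil _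
  have hs₂ : (s : ℝ) < θ ^ 2 * (m + 1) + 1 := Nat.ceil_lt_add_one (by positivity)
  set q := 2 * s + k * (k + 1) with hq
  have hmain : (m : ℝ) * (1 - 13 * θ ^ 2) ≤ m - (2 * q + 1 + 8 * s) := by
    rw [hq]
    push_cast
    nlinarith
  have hmpos : (0 : ℝ) < m * (1 - 13 * θ ^ 2) := mul_pos hm0 (by nlinarith)
  have hqm : 2 * q + 1 + 8 * s < m := by
    have : (2 * q + 1 + 8 * s : ℝ) < m := by linarith
    exact_mod_cast this
  set h := (m - 2 * q) / 2 with hh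
  have hjoin : ∀ H : SimpleGraph V, ∀ U W : good,
      ((H.clusterGraph (θ ^ 2)).comap Subtype.val).Adj U W → H.IsJoined s U.1 W.1 := by
    intro H U W hUW
    have hsize : ∀ X : good, θ ^ 2 * (#X.1 : ℝ) ≤ s := by
      intro X
      refine le_trans ?_ hs₁
      gcongr
      exact_mod_cast hpart₂ X.1 (mem_sdiff.1 X.2).1
    exact isJoined_of_clusterGraph_adj hUW (hsize U) (hsize W)
  obtain ⟨Z₁, Z₂, hZ₁, hZ₂, hZ, hcov⟩ := exists_disjoint_isWideCycle (C := fun U : good => U.1)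
    (s := s) (h := h) (q := q) (hjoin R) (hjoin B)
    (fun U W hUW => P.disjoint (mem_sdiff.1 U.2).1 (mem_sdiff.1 W.2).1
      (fun h => hUW (Subtype.ext h)))
    (fun U => le_trans (by omega) (hpart₁ U.1 (mem_sdiff.1 U.2).1))
    (by
      rw [hq, hcardW]
      have : #good ≤ k := by omega
      gcongr) (by omega) hσ
  refine ⟨Z₁, Z₂, hZ₁, hZ₂, hZ, ?_⟩
  refine le_coverage_of_le (w := #good) (x := 2 * h - 8 * s) hθ hθ₁ hm0 hk0 hnk hθm ?_ ?_ ?_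
  · linarith
  · refine hmain.trans ?_
    have : m ≤ 2 * h + 2 * q + 1 := by omega
    have : (m : ℝ) ≤ 2 * h + 2 * q + 1 := by exact_mod_cast this
    linarith
  · rw [hcardW] at hcov
    have : (#good : ℝ) * (2 * h) ≤ (Z₁.verts ∪ Z₂.verts).ncard + #good * (8 * s) := by
      exact_mod_cast hcov
    linarith

end SimpleGraph

/-- Label `0` is red and label `1` is blue; `c.labelGraph i` is the spanning subgraph of `G`
formed by the edges of colour `i`. -/
theorem mainTheorem2 (η : ℝ) (hη : 0 < η) :
    ∃ n₀ : ℕ, ∀ (V : Type*) [Fintype V] (G : SimpleGraph V) [DecidableRel G.Adj],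
      n₀ ≤ Fintype.card V →
      (3 / 4 + η) * (Fintype.card V : ℝ) < (G.minDegree : ℝ) →
      ∀ c : G.EdgeLabeling (Fin 2),
        ∃ (R : (c.labelGraph 0).Subgraph) (B : (c.labelGraph 1).Subgraph),
          R.IsWideCycle ∧ B.IsWideCycle ∧ Disjoint R.verts B.verts ∧
          (1 - η) * (Fintype.card V : ℝ) ≤ ((R.verts ∪ B.verts).ncard : ℝ) := by
  classical
  obtain ⟨θ, hθη⟩ : ∃ θ, η = 60 * θ := ⟨η / 60, by ring⟩
  subst hθη
  have hθ : 0 < θ := by linarith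
  obtain hθ₁ | hθ₁ := lt_or_ge (1 / 240) θ
  · -- no graph has minimum degree more than its order
    refine ⟨1, fun V _ G _ hV hdeg => ?_⟩
    have : Nonempty V := Fintype.card_pos_iff.1 hV
    have h1 : (G.minDegree : ℝ) < Fintype.card V := by exact_mod_cast G.minDegree_lt_card
    have h2 : (0 : ℝ) ≤ Fintype.card V := Nat.cast_nonneg _
    nlinarith
  obtain ⟨K, hK⟩ := exists_equipartition_isUniform_pair (ε := θ ^ 2) (by positivity)
    (by nlinarith) ⌈1 / θ⌉₊
  set M := ⌈(14 + 2 * ((K : ℝ) * (K + 1))) / θ ^ 2⌉₊ with hM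
  refine ⟨max (K * 16 ^ K) (M * K), fun V _ G _ hV hdeg c => ?_⟩
  obtain ⟨P, hP, hl, hPK, hR, hB⟩ := hK V (c.labelGraph 0) (c.labelGraph 1)
    ((le_max_left _ _).trans hV)
  have hkθ : 1 ≤ θ * #P.parts := by
    have h1 : 1 / θ ≤ #P.parts := (Nat.le_ceil _).trans (by exact_mod_cast hl)
    rwa [div_le_iff₀' hθ] at h1
  have hk0 : 0 < #P.parts := by
    by_contra! hcon
    rw [Nat.le_zero.1 hcon] at hkθ
    norm_num at hkθ
  have hMm : M ≤ Fintype.card V / #P.parts := by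
    rw [Nat.le_div_iff_mul_le hk0]
    exact (Nat.mul_le_mul_left _ hPK).trans ((le_max_right _ _).trans hV)
  refine SimpleGraph.exists_wideCycles_of_isUniform hP hθ hθ₁ ?_ ?_ hkθ ?_ ?_
  · convert hR
  · convert hB
  · have h1 : (14 + 2 * ((K : ℝ) * (K + 1))) / θ ^ 2 ≤ (Fintype.card V / #P.parts : ℕ) :=
      (Nat.le_ceil _).trans (Nat.cast_le.2 hMm)
    rw [div_le_iff₀' (by positivity)] at h1
    refine le_trans ?_ h1
    gcongr
  · intro u
    refine hdeg.le.trans ?_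
    have h1 := G.minDegree_le_degree u
    rw [← SimpleGraph.card_neighborFinset_eq_degree] at h1
    have h2 : G.neighborFinset u ⊆
        ({w | (c.labelGraph 0).Adj u w ∨ (c.labelGraph 1).Adj u w} : Finset V) := by
      intro w hw
      rw [SimpleGraph.mem_neighborFinset] at hw
      rw [mem_filter]
      refine ⟨mem_univ _, ?_⟩
      simp only [SimpleGraph.EdgeLabeling.labelGraph_adj]
      have : ∀ x : Fin 2, x = 0 ∨ x = 1 := by decide
      exact (this (c ⟨s(u, w), hw⟩)).imp (fun h => ⟨hw, h⟩) (fun h => ⟨hw, h⟩)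
    refine (Nat.cast_le.2 (h1.trans (card_le_card h2))).trans_eq ?_
    congr!
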